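/- Let $e_{pq}=E_{pq}-E_{qp}\in\mathfrak{so}(5)$ and $(e_1,\dots,e_{10})=(e_{12},e_{13},e_{14},e_{15},e_{23},e_{24},e_{25},e_{34},e_{35},e_{54})$, a basis of $\mathfrak{so}(5)$ with dual basis $e^1,\dots,e^{10}$. Let $SO(3)\subset SO(5)$ be the subgroup of matrices $\mathrm{diag}(1,1,s)$, with Lie algebra $\mathfrak{so}(3)=\mathrm{span}(e_8,e_9,e_{10})$, let $\mathfrak m=\mathrm{span}(e_1,\dots,e_7)$, and let $V^{5,2}=SO(5)/SO(3)$. Let $P_1=SO(5)\times_{\mathrm{id}}SO(3)\to V^{5,2}$ be the homogeneous principal $SO(3)$-bundle induced by the identity of $SO(3)$; equivalently, $P_1$ is the bundle $SO(5)\to SO(5)/SO(3)$. Let $\alpha=e^8\otimes e_8+e^9\otimes e_9+e^{10}\otimes e_{10}$. Let $(a,b,x,y,z)\in\mathbb R^5$ satisfy $a^2+by>0$, $b^2+ax>0$, $z\ne0$, $xy=ab$ and $$x=a,\qquad y=b,\qquad z^2=4(a^2+b^2)^{4/3},$$ and let $$\varphi=-z\,e^1\wedge(e^{25}+e^{36}+e^{47})+x\,e^{234}+a(-e^{267}+e^{357}-e^{456})+b(e^{237}-e^{246}+e^{345})-y\,e^{567}.$$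 Then $\varphi$ defines an $SO(5)$-invariant $\mathrm G_2$-structure on $V^{5,2}$ which is coclosed, $d{*_\varphi}\varphi=0$. Moreover $\alpha$ is an $SO(5)$-invariant connection on $P_1$, it is a $\mathrm G_2$-instanton, $F_\alpha\wedge{*_\varphi}\varphi=0$, and, for the metric $g_\varphi$ induced by $\varphi$, it satisfies $$d_\alpha^*F_\alpha=0.$$ Hence $\alpha$ is a Yang--Mills connection on $(V^{5,2},g_\varphi)$: it is a critical point of $A\mapsto\int_{V^{5,2}}\|F_A\|^2\,d\mathrm{vol}_{g_\varphi}$ on the space of all connections on $P_1$. Here $d_\alpha^*$ is the formal $L^2$-adjoint of the covariant exterior derivative $d_\alpha$, and $\mathfrak{so}(3)$ carries the invariant inner product $\frac12\mathrm{Tr}(uv^T)$. -/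

import Mathlib

open scoped ContDiff Matrix
open MeasureTheory

namespace StiefelYM

noncomputable section

/-! ### The groups `SO(5) ⊃ SO(3)` and their Lie algebras -/

/-- `SO(n)`. -/
abbrev SO (n : ℕ) := Matrix.specialOrthogonalGroup (Fin n) ℝ

/-- `𝔰𝔬(n)`, skew-symmetric matrices with the commutator bracket. -/
abbrev so (n : ℕ) := LieAlgebra.Orthogonal.so (Fin n) ℝ

theorem coe_inv_SO {n : ℕ} (g : SO n) : ((g⁻¹ : SO n) : Matrix (Fin n) (Fin n) ℝ) = (g.1)ᵀ := by
  rfl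

theorem transpose_mul_SO {n : ℕ} (g : SO n) : (g.1)ᵀ * g.1 = 1 :=
  (Matrix.mem_orthogonalGroup_iff' (Fin n) ℝ).1
    (Matrix.mem_specialOrthogonalGroup_iff.1 g.2).1

theorem mem_SO_of {n : ℕ} {M : Matrix (Fin n) (Fin n) ℝ} (h : M * Mᵀ = 1) (hd : M.det = 1) :
    M ∈ Matrix.specialOrthogonalGroup (Fin n) ℝ :=
  Matrix.mem_specialOrthogonalGroup_iff.2 ⟨(Matrix.mem_orthogonalGroup_iff (Fin n) ℝ).2 h, hd⟩

instance {n : ℕ} : IsTopologicalGroup (SO n) where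
  continuous_mul := by
    refine Continuous.subtype_mk ?_ _
    exact (continuous_subtype_val.comp continuous_fst).mul
      (continuous_subtype_val.comp continuous_snd)
  continuous_inv := by
    refine Continuous.subtype_mk ?_ _
    exact continuous_subtype_val.matrix_transpose

instance {n : ℕ} : CompactSpace (SO n) := by
  refine isCompact_iff_compactSpace.1 ?_
  have hK : IsCompact (X := Matrix (Fin n) (Fin n) ℝ) (Set.univ.pi fun _ : Fin n =>
      Set.univ.pi fun _ : Fin n => Set.Icc (-1 : ℝ) 1) :=
    isCompact_univ_pi fun _ => isCompact_univ_pi fun _ => isCompact_Icc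
  refine IsCompact.of_isClosed_subset (t := (Matrix.specialOrthogonalGroup (Fin n) ℝ : Set (Matrix (Fin n) (Fin n) ℝ)))
    hK ?_ ?_
  · have : (Matrix.specialOrthogonalGroup (Fin n) ℝ : Set (Matrix (Fin n) (Fin n) ℝ)) =
        {M | M * Mᵀ = 1} ∩ {M | M.det = 1} := by
      ext M
      simp [Matrix.mem_specialOrthogonalGroup_iff, Matrix.mem_orthogonalGroup_iff]
    rw [this]
    refine IsClosed.inter (isClosed_eq ?_ continuous_const) (isClosed_eq ?_ continuous_const)
    · exact continuous_id.mul continuous_id.matrix_transpose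
    · exact continuous_id.matrix_det
  · intro M hM i _ j _
    have h := congrFun (congrFun ((Matrix.mem_orthogonalGroup_iff (Fin n) ℝ).1
      (Matrix.mem_specialOrthogonalGroup_iff.1 hM).1) i) i
    rw [Matrix.mul_apply] at h
    simp only [Matrix.transpose_apply, Matrix.one_apply_eq] at h
    have h2 : M i j * M i j ≤ 1 := by
      rw [← h]
      exact Finset.single_le_sum (f := fun k => M i k * M i k)
        (fun k _ => mul_self_nonneg _) (Finset.mem_univ j)
    exact abs_le.1 (abs_le_one_iff_mul_self_le_one.2 h2)

instance {n : ℕ} : MeasurableSpace (SO n) := borel _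

instance {n : ℕ} : BorelSpace (SO n) := ⟨rfl⟩

/-- The block matrix `diag(u, s)`, with `u` of size 2 and `s` of size 3. -/
def block (u : Matrix (Fin 2) (Fin 2) ℝ) (s : Matrix (Fin 3) (Fin 3) ℝ) :
    Matrix (Fin 5) (Fin 5) ℝ :=
  (Matrix.fromBlocks u 0 0 s).reindex finSumFinEquiv finSumFinEquiv

theorem block_mul (u u' : Matrix (Fin 2) (Fin 2) ℝ) (s s' : Matrix (Fin 3) (Fin 3) ℝ) :
    block u s * block u' s' = block (u * u') (s * s') := by
  simp only [block, Matrix.reindex_apply]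
  erw [Matrix.submatrix_mul_equiv]
  simp [Matrix.fromBlocks_multiply]

theorem block_transpose (u : Matrix (Fin 2) (Fin 2) ℝ) (s : Matrix (Fin 3) (Fin 3) ℝ) :
    (block u s)ᵀ = block uᵀ sᵀ := by
  simp only [block, Matrix.reindex_apply, Matrix.transpose_submatrix, Matrix.fromBlocks_transpose,
    Matrix.transpose_zero]

theorem block_one : block 1 1 = 1 := by
  simp only [block, Matrix.fromBlocks_one, Matrix.reindex_apply]
  exact Matrix.submatrix_one_equiv _

theorem block_det (s : Matrix (Fin 3) (Fin 3) ℝ) : (block 1 s).det = s.det := by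
  have := Matrix.det_reindex_self (finSumFinEquiv (m := 2) (n := 3))
    (Matrix.fromBlocks (1 : Matrix (Fin 2) (Fin 2) ℝ) 0 0 s)
  rw [Matrix.det_fromBlocks_zero₂₁, Matrix.det_one, one_mul] at this
  exact this

/-- The embedding `SO(3) → SO(5)`, `s ↦ diag(1, 1, s)`. -/
def incl : SO 3 →* SO 5 where
  toFun s := ⟨block 1 s.1, mem_SO_of
    (by
      have h := (Matrix.mem_orthogonalGroup_iff (Fin 3) ℝ).1
        (Matrix.mem_specialOrthogonalGroup_iff.1 s.2).1
      rw [block_transpose, block_mul, h, Matrix.transpose_one, Matrix.one_mul, block_one])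
    (by rw [block_det]; exact (Matrix.mem_specialOrthogonalGroup_iff.1 s.2).2)⟩
  map_one' := Subtype.ext block_one
  map_mul' s t := Subtype.ext (by
    change block 1 (s.1 * t.1) = block 1 s.1 * block 1 t.1
    rw [block_mul, Matrix.one_mul])

/-- The derivative `𝔰𝔬(3) → 𝔰𝔬(5)`, `s ↦ diag(0, 0, s)`, of `incl`. -/
def lieIncl (s : so 3) : so 5 :=
  ⟨block 0 s.1, by
    have h := (LieAlgebra.Orthogonal.mem_so (Fin 3) ℝ s.1).1 s.2
    rw [LieAlgebra.Orthogonal.mem_so, block_transpose, h]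
    ext i j
    simp only [block, Matrix.reindex_apply, Matrix.submatrix_apply, Matrix.neg_apply]
    rcases (finSumFinEquiv (m := 2) (n := 3)).symm i with a | a <;>
      rcases (finSumFinEquiv (m := 2) (n := 3)).symm j with b | b <;> simp⟩

/-- The adjoint action of `SO(5)` on `𝔰𝔬(5)`. -/
def Ad (u : SO 5) (X : so 5) : so 5 :=
  ⟨u.1 * X.1 * (u⁻¹ : SO 5).1, by
    have h := (LieAlgebra.Orthogonal.mem_so (Fin 5) ℝ X.1).1 X.2
    rw [LieAlgebra.Orthogonal.mem_so, coe_inv_SO]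
    simp [Matrix.transpose_mul, h, Matrix.mul_assoc]⟩

/-- The exponential map `𝔰𝔬(5) → SO(5)`. -/
def expSO (X : so 5) : SO 5 :=
  ⟨NormedSpace.exp X.1, by
    have hX := (LieAlgebra.Orthogonal.mem_so (Fin 5) ℝ X.1).1 X.2
    have key : ∀ M : Matrix (Fin 5) (Fin 5) ℝ, Mᵀ = -M →
        NormedSpace.exp M * (NormedSpace.exp M)ᵀ = 1 := by
      intro M hM
      rw [← Matrix.exp_transpose, hM, Matrix.exp_neg]
      exact Matrix.mul_nonsing_inv _ ((Matrix.isUnit_iff_isUnit_det _).1 (Matrix.isUnit_exp M))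
    refine mem_SO_of (key _ hX) ?_
    have h2 : NormedSpace.exp X.1 =
        NormedSpace.exp ((1 / 2 : ℝ) • X.1) * NormedSpace.exp ((1 / 2 : ℝ) • X.1) := by
      rw [← Matrix.exp_add_of_commute _ _ (Commute.refl _), ← add_smul]
      norm_num
    have h3 := congrArg Matrix.det (key ((1 / 2 : ℝ) • X.1) (by
      rw [Matrix.transpose_smul, hX, smul_neg]))
    rw [Matrix.det_mul, Matrix.det_transpose, Matrix.det_one] at h3
    rw [h2, Matrix.det_mul, h3]⟩

/-! ### The Stiefel manifold and the bundle `P₁` -/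

/-- The Stiefel manifold `V^{5,2} = SO(5)/SO(3)`. -/
abbrev V52 := SO 5 ⧸ incl.range

instance : MeasurableSpace V52 := borel _

instance : BorelSpace V52 := ⟨rfl⟩

/-- The relation `(u, s) ∼ (u r, r⁻¹ s)`, `r ∈ SO(3)`, on `SO(5) × SO(3)`. -/
def P1Setoid : Setoid (SO 5 × SO 3) where
  r p q := ∃ r : SO 3, q = (p.1 * incl r, r⁻¹ * p.2)
  iseqv :=
    { refl := fun p => ⟨1, by simp⟩
      symm := by
        rintro p q ⟨r, rfl⟩
        exact ⟨r⁻¹, by simp [mul_assoc]⟩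
      trans := by
        rintro p q t ⟨r, rfl⟩ ⟨r', rfl⟩
        exact ⟨r * r', by simp [mul_assoc]⟩ }

/-- The total space of the homogeneous bundle `P₁ = SO(5) ×_{id} SO(3)`. -/
def P1 := Quotient P1Setoid

/-- `[(u, s)] ↦ u s` identifies `P₁` with `SO(5)`. It intertwines the left `SO(5)`-actions, the
right `SO(3)`-actions and the projections to `V^{5,2}` (see `P1Equiv_mk` and `P1Equiv_proj`), so
`P₁ → V^{5,2}` is the principal `SO(3)`-bundle `SO(5) → SO(5)/SO(3)`; differential forms on `P₁`
are written as differential forms on `SO(5)` below. -/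
def P1Equiv : P1 ≃ SO 5 where
  toFun := Quotient.lift (s := P1Setoid) (fun p => p.1 * incl p.2) (by
    rintro p q ⟨r, rfl⟩
    simp [mul_assoc])
  invFun u := Quotient.mk P1Setoid (u, 1)
  left_inv := by
    intro p
    induction p using Quotient.inductionOn with
    | _ p => exact Quotient.sound ⟨p.2⁻¹, by simp [mul_assoc]⟩
  right_inv u := by
    change u * incl 1 = u
    simp

theorem P1Equiv_mk (v u : SO 5) (s r : SO 3) :
    P1Equiv (Quotient.mk P1Setoid (v * u, s * r)) =
      v * P1Equiv (Quotient.mk P1Setoid (u, s)) * incl r := by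
  change v * u * incl (s * r) = v * (u * incl s) * incl r
  simp [mul_assoc]

theorem P1Equiv_proj (u : SO 5) (s : SO 3) :
    ((P1Equiv (Quotient.mk P1Setoid (u, s)) : SO 5) : V52) = (u : V52) := by
  change ((u * incl s : SO 5) : V52) = (u : V52)
  exact QuotientGroup.eq.2 ⟨s⁻¹, by simp⟩

/-! ### The basis `e₁, …, e₁₀` of `𝔰𝔬(5)`

Indices are shifted by one: `e 0, …, e 9` are `e₁, …, e₁₀`. The span of `e 7, e 8, e 9` is
`𝔰𝔬(3)`, and `𝔪` is the span of `e 0, …, e 6`. -/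

/-- `e i` is `E_{pq} - E_{qp}` for `(p, q) = pos i`. -/
def pos : Fin 10 → Fin 5 × Fin 5 :=
  ![(0, 1), (0, 2), (0, 3), (0, 4), (1, 2), (1, 3), (1, 4), (2, 3), (2, 4), (4, 3)]

/-- The basis of `𝔰𝔬(5)`. -/
def e (i : Fin 10) : so 5 :=
  ⟨Matrix.single (pos i).1 (pos i).2 1 - Matrix.single (pos i).2 (pos i).1 1, by
    rw [LieAlgebra.Orthogonal.mem_so, Matrix.transpose_sub, Matrix.transpose_single,
      Matrix.transpose_single, neg_sub]⟩

/-- The dual basis: `co i` is `e^{i+1}`. -/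
def co (i : Fin 10) : so 5 →ₗ[ℝ] ℝ where
  toFun X := X.1 (pos i).1 (pos i).2
  map_add' _ _ := rfl
  map_smul' _ _ := rfl

theorem co_e (i j : Fin 10) : co i (e j) = if i = j then 1 else 0 := by
  change (Matrix.single (pos j).1 (pos j).2 (1 : ℝ) - Matrix.single (pos j).2 (pos j).1 1 :
    Matrix (Fin 5) (Fin 5) ℝ) (pos i).1 (pos i).2 = _
  rw [Matrix.sub_apply, Matrix.single_apply, Matrix.single_apply]
  fin_cases i <;> fin_cases j <;> simp [pos]

/-- The inclusion of the index set of `𝔪`. -/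
def mIdx (i : Fin 7) : Fin 10 := Fin.castLE (by norm_num) i

/-- `e₈, e₉, e₁₀` as elements of `𝔰𝔬(3)`. -/
def f (i : Fin 3) : so 3 :=
  ⟨Matrix.single (![0, 0, 2] i) (![1, 2, 1] i) 1 - Matrix.single (![1, 2, 1] i) (![0, 0, 2] i) 1, by
    rw [LieAlgebra.Orthogonal.mem_so, Matrix.transpose_sub, Matrix.transpose_single,
      Matrix.transpose_single, neg_sub]⟩

theorem lieIncl_f (i : Fin 3) : lieIncl (f i) = e (Fin.natAdd 7 i) := by
  apply Subtype.ext
  ext p q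
  change block 0 (f i).1 p q = _
  fin_cases i <;> fin_cases p <;> fin_cases q <;>
    simp [block, f, e, pos, finSumFinEquiv, Fin.addCases, Matrix.fromBlocks,
      Fin.natAdd, Fin.subNat, Fin.castLT]

/-! ### Differential forms on `SO(5)`

The tangent bundle of `SO(5)` is trivialised by left-invariant vector fields. A `k`-form is thus a
function of a point and of `k` elements of `𝔰𝔬(5)`. -/

/-- Smooth functions on the closed submanifold `SO(5)` of the space of matrices. -/
def Smooth (h : SO 5 → ℝ) : Prop :=
  ∃ H : (Fin 5 → Fin 5 → ℝ) → ℝ, ContDiff ℝ ∞ H ∧ ∀ g : SO 5, h g = H (fun i j => g.1 i j)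

/-- The derivative of `h` along the left-invariant vector field of `X`. -/
def lieD (X : so 5) (h : SO 5 → ℝ) (g : SO 5) : ℝ :=
  deriv (fun t : ℝ => h (g * expSO (t • X))) 0

/-- The exterior derivative of a `(k+1)`-form, evaluated on left-invariant vector fields:
`dη(v₀, …) = ∑ᵢ (-1)ⁱ vᵢ(η(…, v̂ᵢ, …)) + ∑_{i<j} (-1)^{i+j} η([vᵢ, vⱼ], …, v̂ᵢ, …, v̂ⱼ, …)`. -/
def extD {k : ℕ} (η : SO 5 → (Fin (k + 1) → so 5) → ℝ) (g : SO 5) (v : Fin (k + 2) → so 5) : ℝ :=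
  (∑ i : Fin (k + 2), (-1) ^ (i : ℕ) * lieD (v i) (fun g' => η g' (i.removeNth v)) g) +
    ∑ j : Fin (k + 2), ∑ i : Fin (k + 1), if i.castSucc < j then
      (-1) ^ ((i : ℕ) + (j : ℕ)) *
        η g (Fin.cons ⁅v i.castSucc, v j⁆ (fun l : Fin k => v (j.succAbove (i.succAbove l))))
    else 0

/-- The wedge product of a vector-valued 2-form and a real `k`-form, at a point:
`(F ∧ η)(v₀, …) = ∑_{i<j} (-1)^{i+j+1} F(vᵢ, vⱼ) η(…, v̂ᵢ, …, v̂ⱼ, …)`. -/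
def wedge2 {E : Type*} [AddCommGroup E] [Module ℝ E] {k : ℕ} (F : (Fin 2 → so 5) → E)
    (η : (Fin k → so 5) → ℝ) (v : Fin (k + 2) → so 5) : E :=
  ∑ j : Fin (k + 2), ∑ i : Fin (k + 1), if i.castSucc < j then
    ((-1 : ℝ) ^ ((i : ℕ) + (j : ℕ) + 1) * η (fun l : Fin k => v (j.succAbove (i.succAbove l)))) •
      F ![v i.castSucc, v j]
  else 0

/-! ### Invariant `G₂`-structures -/

/-- The wedge product of three covectors. -/
def wedge3 (θ₁ θ₂ θ₃ : so 5 →ₗ[ℝ] ℝ) (v : Fin 3 → so 5) : ℝ :=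
  (Matrix.of fun r s : Fin 3 => (![θ₁, θ₂, θ₃] r) (v s)).det

/-- `φ` is an `SO(5)`-invariant `G₂`-structure on `V^{5,2}`: it is horizontal and
`Ad(SO(3))`-invariant, hence a 3-form on `V^{5,2}`, and there is a basis `θ` of the cotangent space
at the origin in which `φ` is the standard 3-form. -/
structure IsInvariantG2Structure (φ : (Fin 3 → so 5) → ℝ) : Prop where
  horizontal : ∀ (v : Fin 3 → so 5) (i : Fin 3), (∃ s : so 3, v i = lieIncl s) → φ v = 0
  invariant : ∀ (h : SO 3) (v : Fin 3 → so 5), φ (fun i => Ad (incl h) (v i)) = φ v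
  coframe : ∃ θ : Fin 7 → so 5 →ₗ[ℝ] ℝ, LinearIndependent ℝ θ ∧
    (∀ (i : Fin 7) (s : so 3), θ i (lieIncl s) = 0) ∧
    ∀ v, φ v = wedge3 (θ 0) (θ 1) (θ 4) v + wedge3 (θ 0) (θ 2) (θ 5) v
      + wedge3 (θ 0) (θ 3) (θ 6) v + wedge3 (θ 1) (θ 2) (θ 3) v - wedge3 (θ 1) (θ 5) (θ 6) v
      + wedge3 (θ 2) (θ 4) (θ 6) v - wedge3 (θ 3) (θ 4) (θ 5) v

/-- The bilinear form `B_{ij} = ((e_i ⌟ φ) ∧ (e_j ⌟ φ) ∧ φ)(e_1, …, e_7)`. -/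
def bil (φ : (Fin 3 → so 5) → ℝ) : Matrix (Fin 7) (Fin 7) ℝ :=
  Matrix.of fun i j => wedge2 (fun w => φ (Fin.cons (e (mIdx i)) w))
    (wedge2 (fun w => φ (Fin.cons (e (mIdx j)) w)) φ) (fun l => e (mIdx l))

/-- The real ninth root. -/
def root9 (t : ℝ) : ℝ := Real.sign t * |t| ^ (1 / 9 : ℝ)

/-- The Gram matrix in the basis `e₁, …, e₇` of `𝔪` of the metric
`g_φ = B / (6^{2/9} det(B)^{1/9})` induced by `φ`. -/
def gram (φ : (Fin 3 → so 5) → ℝ) : Matrix (Fin 7) (Fin 7) ℝ :=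
  (6 ^ (2 / 9 : ℝ) * root9 (bil φ).det)⁻¹ • bil φ

/-- The basis of `𝔪` that is `g_φ`-dual to `e₁, …, e₇`: `g_φ(e_i, eUp φ j) = δ_{ij}`. -/
def eUp (φ : (Fin 3 → so 5) → ℝ) (i : Fin 7) : so 5 :=
  ∑ j : Fin 7, (gram φ)⁻¹ i j • e (mIdx j)

/-- The volume form of `g_φ` in the orientation given by `φ` (the one in which
`(u ⌟ φ) ∧ (v ⌟ φ) ∧ φ = 6 g_φ(u, v) vol`). -/
def volForm (φ : (Fin 3 → so 5) → ℝ) (v : Fin 7 → so 5) : ℝ :=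
  Real.sign (bil φ).det * √(gram φ).det * (Matrix.of fun i j : Fin 7 => co (mIdx i) (v j)).det

/-- The 4-form `ψ = *φ`; here `(*η)(v) = (1/3!) ∑_{i,j,k} η(e_i, e_j, e_k) vol(eⁱ, eʲ, eᵏ, v)`,
with `eⁱ` the `g_φ`-dual basis. -/
def starForm (φ : (Fin 3 → so 5) → ℝ) (v : Fin 4 → so 5) : ℝ :=
  (1 / 6) * ∑ i : Fin 7, ∑ j : Fin 7, ∑ k : Fin 7,
    φ ![e (mIdx i), e (mIdx j), e (mIdx k)] *
      volForm φ ![eUp φ i, eUp φ j, eUp φ k, v 0, v 1, v 2, v 3]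

/-- `φ` is coclosed: `d * φ = 0`. -/
def IsCoclosed (φ : (Fin 3 → so 5) → ℝ) : Prop :=
  ∀ (g : SO 5) (v : Fin 5 → so 5), extD (fun _ => starForm φ) g v = 0

/-- The family of 3-forms
`φ = -z e¹∧(e²⁵+e³⁶+e⁴⁷) + x e²³⁴ + a(-e²⁶⁷+e³⁵⁷-e⁴⁵⁶) + b(e²³⁷-e²⁴⁶+e³⁴⁵) - y e⁵⁶⁷`. -/
def phi (a b x y z : ℝ) (v : Fin 3 → so 5) : ℝ :=
  -z * (wedge3 (co 0) (co 1) (co 4) v + wedge3 (co 0) (co 2) (co 5) v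
      + wedge3 (co 0) (co 3) (co 6) v)
    + x * wedge3 (co 1) (co 2) (co 3) v
    + a * (-wedge3 (co 1) (co 5) (co 6) v + wedge3 (co 2) (co 4) (co 6) v
      - wedge3 (co 3) (co 4) (co 5) v)
    + b * (wedge3 (co 1) (co 2) (co 6) v - wedge3 (co 1) (co 3) (co 5) v
      + wedge3 (co 2) (co 3) (co 4) v)
    - y * wedge3 (co 4) (co 5) (co 6) v

/-! ### Connections on `P₁` -/

/-- `𝔰𝔬(3)`-valued 1-forms on `P₁ = SO(5)`. -/
abbrev OneForm := SO 5 → so 5 →ₗ[ℝ] so 3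

/-- Smoothness of a 1-form. -/
def SmoothForm (A : OneForm) : Prop :=
  ∀ (X : so 5) (p q : Fin 3), Smooth (fun g => (A g X).1 p q)

/-- `R_h^* A = Ad(h⁻¹) A` for `h ∈ SO(3)`. -/
def Equivariant (A : OneForm) : Prop :=
  ∀ (h : SO 3) (g : SO 5) (X : so 5),
    (A (g * incl h) X).1 = (h⁻¹ : SO 3).1 * (A g (Ad (incl h) X)).1 * h.1

/-- Principal connections on `P₁`. -/
structure IsConnection (A : OneForm) : Prop where
  smooth : SmoothForm A
  equivariant : Equivariant A
  vertical : ∀ (g : SO 5) (s : so 3), A g (lieIncl s) = s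

/-- Connections invariant under the left action of `SO(5)` on `P₁`. -/
def IsInvariantConnection (A : OneForm) : Prop :=
  IsConnection A ∧ ∀ (u g : SO 5), A (u * g) = A g

/-- `Ω¹(V^{5,2}, ad P₁)`, as equivariant horizontal 1-forms on `P₁`. -/
structure IsAdForm (β : OneForm) : Prop where
  smooth : SmoothForm β
  equivariant : Equivariant β
  horizontal : ∀ (g : SO 5) (s : so 3), β g (lieIncl s) = 0

/-- The exterior derivative of an `𝔰𝔬(3)`-valued 1-form. -/
def dOne (A : OneForm) (g : SO 5) (v : Fin 2 → so 5) : Matrix (Fin 3) (Fin 3) ℝ :=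
  Matrix.of fun p q => extD (k := 0) (fun g' w => (A g' (w 0)).1 p q) g v

/-- The curvature `F_A = dA + A ∧ A`. -/
def curvature (A : OneForm) (g : SO 5) (v : Fin 2 → so 5) : Matrix (Fin 3) (Fin 3) ℝ :=
  dOne A g v + ((A g (v 0)).1 * (A g (v 1)).1 - (A g (v 1)).1 * (A g (v 0)).1)

/-- The exterior covariant derivative `d_A β = dβ + [A ∧ β]`. -/
def dCov (A β : OneForm) (g : SO 5) (v : Fin 2 → so 5) : Matrix (Fin 3) (Fin 3) ℝ :=
  dOne β g v + (⁅(A g (v 0)).1, (β g (v 1)).1⁆ - ⁅(A g (v 1)).1, (β g (v 0)).1⁆)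

/-- The invariant inner product `½ Tr(a bᵀ)` on `𝔰𝔬(3)`. -/
def ip (a b : Matrix (Fin 3) (Fin 3) ℝ) : ℝ := (1 / 2) * (a * bᵀ).trace

/-- The pointwise inner product of `𝔰𝔬(3)`-valued 1-forms on `𝔪` for `g_φ`. -/
def ip1 (φ : (Fin 3 → so 5) → ℝ) (β γ : so 5 →ₗ[ℝ] so 3) : ℝ :=
  ∑ i : Fin 7, ip (β (e (mIdx i))).1 (γ (eUp φ i)).1

/-- The pointwise inner product of `𝔰𝔬(3)`-valued 2-forms on `𝔪` for `g_φ`. -/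
def ip2 (φ : (Fin 3 → so 5) → ℝ) (F F' : (Fin 2 → so 5) → Matrix (Fin 3) (Fin 3) ℝ) : ℝ :=
  (1 / 2) * ∑ i : Fin 7, ∑ j : Fin 7,
    ip (F ![e (mIdx i), e (mIdx j)]) (F' ![eUp φ i, eUp φ j])

/-- The Riemannian volume measure of `g_φ` on `V^{5,2}`. It is the invariant measure of total mass
`√(det g_φ) · 16π⁴/3`; the metric in which `e₁, …, e₇` are orthonormal makes `V^{5,2} → S⁴` a
Riemannian submersion with fibres the unit `S³`, so its volume is `(8π²/3)(2π²) = 16π⁴/3`. -/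
def volV (φ : (Fin 3 → so 5) → ℝ) : Measure V52 :=
  ENNReal.ofReal (√(gram φ).det * (16 * Real.pi ^ 4 / 3)) •
    (Measure.haarMeasure (⊤ : TopologicalSpace.PositiveCompacts (SO 5))).map
      (fun g : SO 5 => (g : V52))

/-- The `L²`-product on `Ω¹(V^{5,2}, ad P₁)`. The integrand at `p` is computed at a point of the
fibre over `p`, and does not depend on it. -/
def l2One (φ : (Fin 3 → so 5) → ℝ) (β γ : OneForm) : ℝ :=
  ∫ p : V52, ip1 φ (β p.out) (γ p.out) ∂(volV φ)

/-- The `L²`-product on `Ω²(V^{5,2}, ad P₁)`. -/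
def l2Two (φ : (Fin 3 → so 5) → ℝ) (F F' : SO 5 → (Fin 2 → so 5) → Matrix (Fin 3) (Fin 3) ℝ) : ℝ :=
  ∫ p : V52, ip2 φ (F p.out) (F' p.out) ∂(volV φ)

/-- `γ = d_A^* F`, where `d_A^*` is the formal adjoint of `d_A` for the `L²`-products. -/
def IsCodifferential (φ : (Fin 3 → so 5) → ℝ) (A : OneForm)
    (F : SO 5 → (Fin 2 → so 5) → Matrix (Fin 3) (Fin 3) ℝ) (γ : OneForm) : Prop :=
  IsAdForm γ ∧ ∀ β : OneForm, IsAdForm β → l2One φ γ β = l2Two φ F (dCov A β)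

/-- The Yang–Mills functional `∫ ‖F_A‖² dvol`. -/
def YM (φ : (Fin 3 → so 5) → ℝ) (A : OneForm) : ℝ := l2Two φ (curvature A) (curvature A)

/-- Critical points of the Yang–Mills functional on the affine space of connections, which is
modelled on `Ω¹(V^{5,2}, ad P₁)`. -/
def IsYangMills (φ : (Fin 3 → so 5) → ℝ) (A : OneForm) : Prop :=
  IsConnection A ∧
    ∀ β : OneForm, IsAdForm β → HasDerivAt (fun t : ℝ => YM φ (A + t • β)) 0 0

/-- The `G₂`-instanton equation `F_A ∧ *φ = 0`. -/
def IsG2Instanton (φ : (Fin 3 → so 5) → ℝ) (A : OneForm) : Prop :=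
  IsConnection A ∧
    ∀ (g : SO 5) (v : Fin 6 → so 5), wedge2 (curvature A g) (starForm φ) v = 0

/-- `α = e⁸ ⊗ e₈ + e⁹ ⊗ e₉ + e¹⁰ ⊗ e₁₀`. -/
def alpha : OneForm := fun _ => ∑ i : Fin 3, (co (Fin.natAdd 7 i)).smulRight (f i)

end

end StiefelYM

open StiefelYM

namespace StiefelYM

/-! ### Wedge products of the dual basis -/

/-! Put ζ_p = e^{p+1} + i e^{p+4} for p = 1, 2, 3, let ω = e²⁵ + e³⁶ + e⁴⁷ and Ω = ζ₁ ∧ ζ₂ ∧ ζ₃. The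
conditions x = a, y = b say exactly that φ = -z e¹ ∧ ω + Re((a - ib) Ω) (`phi_eq_complex`). `SO(3)`
acts on the ζ_p by real matrices of determinant 1, so it preserves e¹, ω and Ω, hence φ (`phi_Ad`).
Multiplying each ζ_p by a cube root of a - ib and rescaling e¹ gives a standard coframe
(`isInvariantG2Structure_phi`).

The form B is diagonal, with one value on e₁ and another on e₂, …, e₇ (`bil_phi`). Everything metric
below uses only this shape of the inverse Gram matrix (`exists_gram_phi_inv`). It makes *φ a
combination of ω² and e¹ ∧ Im((a - ib) Ω) (`exists_starForm_phi`), and both are closed because de¹ =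
ω and dΩ = 3i e¹ ∧ Ω. The entries of F_α are Re(ζ_p ∧ ζ̄_q) (`curvature_alpha`): primitive forms of
type (1,1), which wedge to zero with ω² and with Ω. Both facts are verified by expanding into
monomials and sorting indices.

For the Yang–Mills equation, take β horizontal. Since α vanishes on 𝔪, d_αβ and dβ agree there. F_α
has constant coefficients, and on basis vectors it is nonzero only for pairs whose bracket lies in
𝔰𝔬(3) (`curvature_alpha_basis`), where β kills the bracket. What remains of dβ are derivatives along
left-invariant fields, and these integrate to zero because Haar measure is right-invariant
(`integral_lieD`). Hence ∫⟨F_α, d_αβ⟩ = 0, which is both d_α^* F_α = 0 and the vanishing of the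
linear coefficient of the quartic polynomial t ↦ YM(α + tβ). -/

theorem so_apply_swap {n : ℕ} (X : so n) (i j : Fin n) : X.1 j i = -X.1 i j := by
  have h := congrFun (congrFun ((LieAlgebra.Orthogonal.mem_so (Fin n) ℝ X.1).1 X.2) i) j
  simpa using h

theorem so_apply_self {n : ℕ} (X : so n) (i : Fin n) : X.1 i i = 0 := by
  have h := so_apply_swap X i i
  linarith

/-- The wedge product of the covectors `co (r 0), co (r 1), …`. -/
noncomputable def coWedge {n : ℕ} (r : Fin n → Fin 10) (v : Fin n → so 5) : ℝ :=
  (Matrix.of fun p q => co (r p) (v q)).det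

theorem coWedge_pair (s t : Fin 10) (v : Fin 2 → so 5) :
    coWedge ![s, t] v = co s (v 0) * co t (v 1) - co s (v 1) * co t (v 0) := by
  simp [coWedge, Matrix.det_fin_two]

theorem coWedge_cons_right {n : ℕ} (r : Fin (n + 1) → Fin 10) (X : so 5) (v : Fin n → so 5) :
    coWedge r (Fin.cons X v) =
      ∑ p : Fin (n + 1), (-1) ^ (p : ℕ) * co (r p) X * coWedge (fun l => r (p.succAbove l)) v := by
  rw [coWedge, Matrix.det_succ_column_zero]
  refine Finset.sum_congr rfl fun p _ => ?_
  simp only [Matrix.of_apply, Fin.cons_zero]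
  rfl

theorem coWedge_cons_left {n : ℕ} (s : Fin 10) (r : Fin n → Fin 10) (v : Fin (n + 1) → so 5) :
    coWedge (Fin.cons s r) v =
      ∑ p : Fin (n + 1), (-1) ^ (p : ℕ) * co s (v p) * coWedge r (fun l => v (p.succAbove l)) := by
  rw [coWedge, Matrix.det_succ_row_zero]
  refine Finset.sum_congr rfl fun p _ => ?_
  simp only [Matrix.of_apply, Fin.cons_zero]
  rfl

theorem coWedge_comp_perm {n : ℕ} (σ : Equiv.Perm (Fin n)) (r : Fin n → Fin 10)
    (v : Fin n → so 5) : coWedge (r ∘ σ) v = (Equiv.Perm.sign σ : ℤ) * coWedge r v := by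
  rw [coWedge, coWedge, ← Matrix.det_permute]
  rfl

theorem coWedge_swap {n : ℕ} {i j : Fin n} (hij : i ≠ j) (r : Fin n → Fin 10)
    (v : Fin n → so 5) : coWedge r v = -coWedge (r ∘ Equiv.swap i j) v := by
  rw [coWedge_comp_perm, Equiv.Perm.sign_swap hij]
  simp

theorem coWedge_eq_zero {n : ℕ} {i j : Fin n} (hij : i ≠ j) (r : Fin n → Fin 10)
    (h : r i = r j) (v : Fin n → so 5) : coWedge r v = 0 := by
  refine Matrix.det_zero_of_row_eq hij ?_
  ext q
  simp [h]

/-- Deleting two positions gives the same list whichever is deleted first. This identifies the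
minors in the two orders of a double Laplace expansion. -/
theorem succ_succAbove_succAbove {k : ℕ} {i j : Fin (k + 1)} (h : i ≤ j) (l : Fin k) :
    j.succ.succAbove (i.succAbove l) = i.castSucc.succAbove (j.succAbove l) := by
  rw [Fin.le_def] at h
  apply Fin.ext
  simp only [Fin.succAbove, Fin.lt_def]
  split_ifs <;> simp_all <;> omega

/-- The index (j, i) stands for the ordered pair of distinct positions j and `j.succAbove i`. The
sum is split by which of the two is larger, and the second half is reindexed by the smaller position
first. -/
theorem sum_pairs {k : ℕ} (g : Fin (k + 2) → Fin (k + 1) → ℝ) :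
    ∑ j, ∑ i, g j i =
      ∑ j : Fin (k + 2), ∑ i : Fin (k + 1), (if i.castSucc < j then g j i else 0) +
      ∑ j : Fin (k + 1), ∑ i : Fin (k + 1), if i ≤ j then g i.castSucc j else 0 := by
  have h1 : ∀ j i, g j i = (if i.castSucc < j then g j i else 0) +
      (if j ≤ i.castSucc then g j i else 0) := by
    intro j i
    rcases lt_or_ge i.castSucc j with h | h
    · simp [h]
    · simp [h, not_lt.2 h]
  conv_lhs => enter [2, j, 2, i]; rw [h1 j i]
  simp only [Finset.sum_add_distrib]
  congr 1
  -- The last j has no position after it, so in the second half j runs over `castSucc` only.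
  rw [Fin.sum_univ_castSucc]
  have h2 : ∑ i : Fin (k + 1), (if Fin.last (k + 1) ≤ i.castSucc then
      g (Fin.last (k + 1)) i else 0) = 0 :=
    Finset.sum_eq_zero fun i _ => if_neg (not_le.2 (Fin.castSucc_lt_last i))
  rw [h2, add_zero, Finset.sum_comm]
  simp only [Fin.castSucc_le_castSucc_iff]

/-- Laplace expansion along the first two rows: the two orders in which a pair of columns is removed
carry opposite signs and combine into the 2 × 2 minor `coWedge ![s, t]`. -/
theorem wedge2_coWedge {k : ℕ} (s t : Fin 10) (r : Fin k → Fin 10) (v : Fin (k + 2) → so 5) :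
    wedge2 (coWedge ![s, t]) (coWedge r) v = coWedge (Fin.cons s (Fin.cons t r)) v := by
  rw [coWedge_cons_left]
  simp only [coWedge_cons_left, Finset.mul_sum]
  rw [sum_pairs, wedge2]
  -- No position precedes j = 0, so j may be shifted to a successor.
  have h0 : ∀ F : Fin (k + 2) → Fin (k + 1) → ℝ,
      ∑ j : Fin (k + 2), ∑ i : Fin (k + 1), (if i.castSucc < j then F j i else 0) =
      ∑ j : Fin (k + 1), ∑ i : Fin (k + 1), (if i ≤ j then F j.succ i else 0) := by
    intro F
    rw [Fin.sum_univ_succ]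
    simp [Fin.castSucc_lt_succ_iff]
  rw [h0, h0, ← Finset.sum_add_distrib]
  refine Finset.sum_congr rfl fun j _ => ?_
  rw [← Finset.sum_add_distrib]
  refine Finset.sum_congr rfl fun i _ => ?_
  split_ifs with h
  · simp only [coWedge_pair, succ_succAbove_succAbove h]
    have e1 : j.succ.succAbove i = i.castSucc := Fin.succAbove_of_castSucc_lt _ _
      (Fin.castSucc_lt_succ_iff.2 h)
    have e2 : i.castSucc.succAbove j = j.succ := Fin.succAbove_of_le_castSucc _ _
      (Fin.castSucc_le_castSucc_iff.2 h)
    rw [e1, e2]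
    simp only [Matrix.cons_val_zero, Matrix.cons_val_one, smul_eq_mul, Fin.val_succ,
      Fin.val_castSucc, pow_add, pow_one]
    ring
  · simp

/-! ### Linearity of the wedge product -/

theorem wedge2_add_left {E : Type*} [AddCommGroup E] [Module ℝ E] {k : ℕ}
    (F F' : (Fin 2 → so 5) → E) (η : (Fin k → so 5) → ℝ) (v : Fin (k + 2) → so 5) :
    wedge2 (F + F') η v = wedge2 F η v + wedge2 F' η v := by
  simp only [wedge2, ← Finset.sum_add_distrib]
  refine Finset.sum_congr rfl fun j _ => Finset.sum_congr rfl fun i _ => ?_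
  split_ifs <;> simp

theorem wedge2_neg_left {E : Type*} [AddCommGroup E] [Module ℝ E] {k : ℕ}
    (F : (Fin 2 → so 5) → E) (η : (Fin k → so 5) → ℝ) (v : Fin (k + 2) → so 5) :
    wedge2 (-F) η v = -wedge2 F η v := by
  simp only [wedge2, ← Finset.sum_neg_distrib]
  refine Finset.sum_congr rfl fun j _ => Finset.sum_congr rfl fun i _ => ?_
  split_ifs <;> simp

theorem wedge2_sub_left {E : Type*} [AddCommGroup E] [Module ℝ E] {k : ℕ}
    (F F' : (Fin 2 → so 5) → E) (η : (Fin k → so 5) → ℝ) (v : Fin (k + 2) → so 5) :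
    wedge2 (F - F') η v = wedge2 F η v - wedge2 F' η v := by
  rw [sub_eq_add_neg, wedge2_add_left, wedge2_neg_left, sub_eq_add_neg]

theorem wedge2_add_right {E : Type*} [AddCommGroup E] [Module ℝ E] {k : ℕ}
    (F : (Fin 2 → so 5) → E) (η η' : (Fin k → so 5) → ℝ) (v : Fin (k + 2) → so 5) :
    wedge2 F (η + η') v = wedge2 F η v + wedge2 F η' v := by
  simp only [wedge2, ← Finset.sum_add_distrib]
  refine Finset.sum_congr rfl fun j _ => Finset.sum_congr rfl fun i _ => ?_
  split_ifs <;> simp [mul_add, add_smul]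

theorem wedge2_smul_right {E : Type*} [AddCommGroup E] [Module ℝ E] {k : ℕ} (c : ℝ)
    (F : (Fin 2 → so 5) → E) (η : (Fin k → so 5) → ℝ) (v : Fin (k + 2) → so 5) :
    wedge2 F (c • η) v = c • wedge2 F η v := by
  simp only [wedge2, Finset.smul_sum]
  refine Finset.sum_congr rfl fun j _ => Finset.sum_congr rfl fun i _ => ?_
  split_ifs
  · rw [smul_smul]
    congr 1
    simp only [Pi.smul_apply, smul_eq_mul]
    ring
  · simp

/-! ### Exterior derivative of left-invariant forms -/

theorem lieD_const (X : so 5) (c : ℝ) (g : SO 5) : lieD X (fun _ => c) g = 0 := by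
  simp [lieD]

/-- Constant coefficients leave only the bracket terms. Expanding the determinant along the column
of the bracket gives the Leibniz rule, with d(co r) = -co r ∘ [·,·]. -/
theorem extD_const_coWedge {k : ℕ} (r : Fin (k + 1) → Fin 10) (g : SO 5)
    (v : Fin (k + 2) → so 5) :
    extD (fun _ => coWedge r) g v = -∑ p : Fin (k + 1), (-1) ^ (p : ℕ) *
      wedge2 (fun w => co (r p) ⁅w 0, w 1⁆) (coWedge fun l => r (p.succAbove l)) v := by
  simp only [extD, lieD_const, mul_zero, Finset.sum_const_zero, zero_add, wedge2, Finset.mul_sum]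
  conv_rhs => rw [Finset.sum_comm, ← Finset.sum_neg_distrib]
  refine Finset.sum_congr rfl fun j _ => ?_
  conv_rhs => rw [Finset.sum_comm, ← Finset.sum_neg_distrib]
  refine Finset.sum_congr rfl fun i _ => ?_
  split_ifs
  · rw [coWedge_cons_right, Finset.mul_sum, ← Finset.sum_neg_distrib]
    refine Finset.sum_congr rfl fun p _ => ?_
    simp only [Matrix.cons_val_zero, Matrix.cons_val_one, smul_eq_mul, pow_add, pow_one]
    ring
  · simp

theorem extD_const_add {k : ℕ} (η η' : (Fin (k + 1) → so 5) → ℝ) (g : SO 5)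
    (v : Fin (k + 2) → so 5) :
    extD (fun _ => η + η') g v = extD (fun _ => η) g v + extD (fun _ => η') g v := by
  simp only [extD, lieD_const, mul_zero, Finset.sum_const_zero, zero_add,
    ← Finset.sum_add_distrib]
  refine Finset.sum_congr rfl fun j _ => Finset.sum_congr rfl fun i _ => ?_
  split_ifs <;> simp [mul_add]

theorem extD_const_smul {k : ℕ} (c : ℝ) (η : (Fin (k + 1) → so 5) → ℝ) (g : SO 5)
    (v : Fin (k + 2) → so 5) :
    extD (fun _ => c • η) g v = c * extD (fun _ => η) g v := by
  simp only [extD, lieD_const, mul_zero, Finset.sum_const_zero, zero_add, Finset.mul_sum]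
  refine Finset.sum_congr rfl fun j _ => Finset.sum_congr rfl fun i _ => ?_
  split_ifs <;> simp [mul_left_comm]

/-! ### Structure equations of `𝔰𝔬(5)` -/

theorem so_bracket_apply {n : ℕ} (X Y : so n) (i j : Fin n) :
    (⁅X, Y⁆ : so n).1 i j = ∑ k, (X.1 i k * Y.1 k j - Y.1 i k * X.1 k j) := by
  rw [Finset.sum_sub_distrib]
  rfl

theorem co_apply (i : Fin 10) (X : so 5) : co i X = X.1 (pos i).1 (pos i).2 := rfl

/-- The exterior derivative of `co r`, up to sign. -/
noncomputable def coBracket (r : Fin 7) : (Fin 2 → so 5) → ℝ :=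
  ![-(coWedge ![1, 4] + coWedge ![2, 5] + coWedge ![3, 6]),
    coWedge ![0, 4] - coWedge ![2, 7] - coWedge ![3, 8],
    coWedge ![0, 5] + coWedge ![1, 7] + coWedge ![3, 9],
    coWedge ![0, 6] + coWedge ![1, 8] - coWedge ![2, 9],
    -(coWedge ![0, 1] + coWedge ![5, 7] + coWedge ![6, 8]),
    -(coWedge ![0, 2] - coWedge ![4, 7] - coWedge ![6, 9]),
    -(coWedge ![0, 3] - coWedge ![4, 8] + coWedge ![5, 9])] r

theorem co_bracket (r : Fin 7) : (fun w => co (mIdx r) ⁅w 0, w 1⁆) = coBracket r := by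
  funext w
  -- These instances bring every matrix entry to the orientation chosen in `pos`; the last pair is
  -- (4, 3), since e₁₀ = e₅₄.
  have h := so_apply_swap (w 0)
  have h' := so_apply_swap (w 1)
  fin_cases r <;>
    simp [coBracket, mIdx, co_apply, so_bracket_apply, Fin.sum_univ_five, coWedge_pair, pos,
      so_apply_self, h 0 1, h 1 2, h 1 3, h 1 4, h 2 3, h 2 4, h 4 3,
      h' 0 1, h' 1 2, h' 1 3, h' 1 4, h' 2 3, h' 2 4, h' 4 3] <;>
    ring

/-! ### Values of `φ` on the basis -/

theorem wedge3_co (i j k : Fin 10) : wedge3 (co i) (co j) (co k) = coWedge ![i, j, k] := by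
  funext v
  rw [wedge3, coWedge]
  congr 1
  ext p q
  fin_cases p <;> rfl

/-- The family `φ` for `x = a`, `y = b`. -/
theorem phi_eq (a b z : ℝ) : phi a b a b z =
    (-z) • (coWedge ![0, 1, 4] + coWedge ![0, 2, 5] + coWedge ![0, 3, 6]) +
    (a • (coWedge ![1, 2, 3] - coWedge ![1, 5, 6] + coWedge ![2, 4, 6] - coWedge ![3, 4, 5]) +
    b • (coWedge ![1, 2, 6] - coWedge ![1, 3, 5] + coWedge ![2, 3, 4] - coWedge ![4, 5, 6])) := by
  funext v
  simp only [phi, wedge3_co, Pi.add_apply, Pi.smul_apply, Pi.sub_apply, smul_eq_mul]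
  ring

/-- The determinant of the pairings of three dual basis vectors with three basis vectors. -/
def deltaDet (p q r i j k : Fin 10) : ℤ :=
  let d (x y : Fin 10) : ℤ := if x = y then 1 else 0
  d p i * d q j * d r k - d p i * d q k * d r j - d p j * d q i * d r k + d p j * d q k * d r i +
    d p k * d q i * d r j - d p k * d q j * d r i

theorem coWedge_three_basis (p q r i j k : Fin 10) :
    coWedge ![p, q, r] ![e i, e j, e k] = deltaDet p q r i j k := by
  simp [coWedge, Matrix.det_fin_three, co_e, deltaDet]

/-- The values on the basis of `𝔪` of the coefficients of `z`, `a`, `b` in `φ`. A triple of indices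
is encoded by the sum of the corresponding powers of 2. -/
def phiCoeff (c : Fin 3) (i j k : Fin 7) : ℤ :=
  let m := 2 ^ i.val + 2 ^ j.val + 2 ^ k.val
  (![if m = 19 ∨ m = 37 ∨ m = 73 then -1 else 0,
    if m = 14 ∨ m = 84 then 1 else if m = 98 ∨ m = 56 then -1 else 0,
    if m = 70 ∨ m = 28 then 1 else if m = 42 ∨ m = 112 then -1 else 0] : Fin 3 → ℤ) c *
  (((j : ℤ) - i) * (k - i) * (k - j)).sign

/-- Separating the coefficients of z, a, b makes all values integers, so the comparison is a finite
decidable check over the triples of indices. -/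
theorem phiCoeff_eq_deltaDet : ∀ i j k : Fin 7,
    let D (p q r : Fin 10) := deltaDet p q r (mIdx i) (mIdx j) (mIdx k)
    phiCoeff 0 i j k = -(D 0 1 4 + D 0 2 5 + D 0 3 6) ∧
      phiCoeff 1 i j k = D 1 2 3 - D 1 5 6 + D 2 4 6 - D 3 4 5 ∧
      phiCoeff 2 i j k = D 1 2 6 - D 1 3 5 + D 2 3 4 - D 4 5 6 := by
  decide +kernel

theorem phi_basis (a b z : ℝ) (i j k : Fin 7) :
    phi a b a b z ![e (mIdx i), e (mIdx j), e (mIdx k)] =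
      ∑ c, ![z, a, b] c * (phiCoeff c i j k : ℝ) := by
  obtain ⟨h0, h1, h2⟩ := phiCoeff_eq_deltaDet i j k
  rw [phi_eq, Fin.sum_univ_three, h0, h1, h2]
  simp only [Pi.add_apply, Pi.smul_apply, Pi.sub_apply, coWedge_three_basis, Matrix.cons_val,
    smul_eq_mul]
  push_cast
  ring

/-- The coefficient `(e_i ⌟ p) ∧ (e_j ⌟ q) ∧ r` on the basis of `𝔪`. -/
def bilCoeff {R : Type*} [CommRing R] (p q r : Fin 7 → Fin 7 → Fin 7 → R) (i j : Fin 7) : R :=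
  ∑ m : Fin 7, ∑ l : Fin 6, if l.castSucc < m then (-1) ^ ((l : ℕ) + (m : ℕ) + 1) *
    (∑ m' : Fin 5, ∑ l' : Fin 4, if l'.castSucc < m' then (-1) ^ ((l' : ℕ) + (m' : ℕ) + 1) *
      r (m.succAbove (l.succAbove (m'.succAbove (l'.succAbove 0))))
        (m.succAbove (l.succAbove (m'.succAbove (l'.succAbove 1))))
        (m.succAbove (l.succAbove (m'.succAbove (l'.succAbove 2)))) *
      q j (m.succAbove (l.succAbove l'.castSucc)) (m.succAbove (l.succAbove m')) else 0) *
    p i l.castSucc m else 0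

theorem bil_eq_bilCoeff (φ : (Fin 3 → so 5) → ℝ) (i j : Fin 7) :
    bil φ i j = bilCoeff (fun i j k => φ ![e (mIdx i), e (mIdx j), e (mIdx k)])
      (fun i j k => φ ![e (mIdx i), e (mIdx j), e (mIdx k)])
      (fun i j k => φ ![e (mIdx i), e (mIdx j), e (mIdx k)]) i j := by
  have h : ∀ v : Fin 3 → so 5, φ v = φ ![v 0, v 1, v 2] := fun v => by
    congr 1
    ext1 l
    fin_cases l <;> rfl
  simp only [bil, Matrix.of_apply, wedge2, bilCoeff, smul_eq_mul]
  refine Finset.sum_congr rfl fun m _ => Finset.sum_congr rfl fun l _ => ?_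
  split_ifs
  · congr 2
    refine Finset.sum_congr rfl fun m' _ => Finset.sum_congr rfl fun l' _ => ?_
    split_ifs
    · rw [h (fun _ => _)]
      rfl
    · rfl
  · rfl

theorem sum_ite_sum_mul {ι : Type*} [Fintype ι] {n k : ℕ} (x : ι → ℝ)
    (P : Fin n → Fin k → Prop) [∀ m l, Decidable (P m l)] (A : ι → Fin n → Fin k → ℝ) :
    (∑ m, ∑ l, if P m l then ∑ c, x c * A c m l else 0) =
      ∑ c, x c * ∑ m, ∑ l, if P m l then A c m l else 0 := by
  simp only [Finset.mul_sum]
  rw [Finset.sum_comm]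
  conv_rhs => rw [Finset.sum_comm]; enter [2, m]; rw [Finset.sum_comm]
  rw [Finset.sum_comm]
  refine Finset.sum_congr rfl fun m _ => Finset.sum_congr rfl fun l _ => ?_
  split_ifs <;> simp

/-- Trilinearity: the entries of B, cubic polynomials in z, a, b, are reduced to integer arrays
indexed by three choices of coefficient. -/
theorem bilCoeff_sum {ι : Type*} [Fintype ι] (x : ι → ℝ)
    (t : ι → Fin 7 → Fin 7 → Fin 7 → ℝ) (i j : Fin 7) :
    bilCoeff (fun i j k => ∑ c, x c * t c i j k) (fun i j k => ∑ c, x c * t c i j k)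
      (fun i j k => ∑ c, x c * t c i j k) i j =
      ∑ c, x c * ∑ c', x c' * ∑ c'', x c'' * bilCoeff (t c) (t c') (t c'') i j := by
  have h1 : ∀ q r, bilCoeff (fun i j k => ∑ c, x c * t c i j k) q r i j =
      ∑ c, x c * bilCoeff (t c) q r i j := by
    intro q r
    simp only [bilCoeff]
    rw [← sum_ite_sum_mul]
    simp only [Finset.mul_sum _ _ (_ * _), mul_left_comm]
  have h2 : ∀ p r, bilCoeff p (fun i j k => ∑ c, x c * t c i j k) r i j =
      ∑ c, x c * bilCoeff p (t c) r i j := by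
    intro p r
    simp only [bilCoeff]
    simp only [Finset.mul_sum (s := Finset.univ (α := ι)), mul_left_comm _ (x _)]
    simp only [sum_ite_sum_mul]
    simp only [Finset.mul_sum (s := Finset.univ (α := ι)),
      Finset.sum_mul (s := Finset.univ (α := ι)), mul_left_comm _ (x _), mul_assoc]
    simp only [sum_ite_sum_mul]
  have h3 : ∀ p q, bilCoeff p q (fun i j k => ∑ c, x c * t c i j k) i j =
      ∑ c, x c * bilCoeff p q (t c) i j := by
    intro p q
    simp only [bilCoeff]
    simp only [Finset.mul_sum (s := Finset.univ (α := ι)),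
      Finset.sum_mul (s := Finset.univ (α := ι)), mul_left_comm _ (x _), mul_assoc]
    simp only [sum_ite_sum_mul]
    simp only [Finset.mul_sum (s := Finset.univ (α := ι)),
      Finset.sum_mul (s := Finset.univ (α := ι)), mul_left_comm _ (x _), mul_assoc]
    simp only [sum_ite_sum_mul]
  simp only [h1, h2, h3]

theorem bilCoeff_intCast (p q r : Fin 7 → Fin 7 → Fin 7 → ℤ) (i j : Fin 7) :
    bilCoeff (fun i j k => (p i j k : ℝ)) (fun i j k => (q i j k : ℝ))
      (fun i j k => (r i j k : ℝ)) i j = (bilCoeff p q r i j : ℤ) := by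
  simp only [bilCoeff]
  push_cast
  rfl

/-- The guards only drop terms that vanish anyway. They keep the kernel evaluation of `bilCoeff`
short, since the coefficient arrays are sparse. -/
theorem bilCoeff_prune {R : Type*} [CommRing R] [DecidableEq R]
    (p q r : Fin 7 → Fin 7 → Fin 7 → R) (i j : Fin 7) : bilCoeff p q r i j =
  ∑ m : Fin 7, ∑ l : Fin 6, if l.castSucc < m then
    if p i l.castSucc m = 0 then 0 else
    (-1) ^ ((l : ℕ) + (m : ℕ) + 1) *
    (∑ m' : Fin 5, ∑ l' : Fin 4, if l'.castSucc < m' then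
      if q j (m.succAbove (l.succAbove l'.castSucc)) (m.succAbove (l.succAbove m')) = 0 then 0 else
      (-1) ^ ((l' : ℕ) + (m' : ℕ) + 1) *
      r (m.succAbove (l.succAbove (m'.succAbove (l'.succAbove 0))))
        (m.succAbove (l.succAbove (m'.succAbove (l'.succAbove 1))))
        (m.succAbove (l.succAbove (m'.succAbove (l'.succAbove 2)))) *
      q j (m.succAbove (l.succAbove l'.castSucc)) (m.succAbove (l.succAbove m')) else 0) *
    p i l.castSucc m else 0 := by
  simp only [bilCoeff]
  refine Finset.sum_congr rfl fun m _ => Finset.sum_congr rfl fun l _ => ?_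
  congr 1
  split_ifs with h
  · simp [h]
  · congr 2
    refine Finset.sum_congr rfl fun m' _ => Finset.sum_congr rfl fun l' _ => ?_
    congr 1
    split_ifs with h
    · simp [h]
    · rfl

/-- Off the diagonal the value changes sign when the labels 1 and 2 are exchanged, and it vanishes
if a label repeats. Hence the contributions to zab cancel in the full sum. -/
theorem bilCoeff_phiCoeff : ∀ c c' c'' : Fin 3, ∀ i j : Fin 7,
    bilCoeff (phiCoeff c) (phiCoeff c') (phiCoeff c'') i j =
      if i = j then
        if i = 0 then if c = 0 ∧ c' = 0 ∧ c'' = 0 then 6 else 0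
        else if (c = 0 ∧ c' = c'' ∧ c' ≠ 0) ∨ (c' = 0 ∧ c = c'' ∧ c ≠ 0) ∨
          (c'' = 0 ∧ c = c' ∧ c ≠ 0) then 2 else 0
      else (((c' : ℤ) - c) * (c'' - c) * (c'' - c') * if c'' = 0 then -1 else 1) *
        if i.val = j.val + 3 ∧ j ≠ 0 then 1 else if j.val = i.val + 3 ∧ i ≠ 0 then -1 else 0 := by
  simp only [bilCoeff_prune]
  decide +kernel

theorem bil_phi (a b z : ℝ) : bil (phi a b a b z) =
    Matrix.diagonal fun i => if i = 0 then 6 * z ^ 3 else 6 * z * (a ^ 2 + b ^ 2) := by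
  ext i j
  rw [bil_eq_bilCoeff]
  simp only [phi_basis]
  rw [bilCoeff_sum]
  simp only [bilCoeff_intCast, bilCoeff_phiCoeff, Fin.sum_univ_three, Matrix.diagonal_apply]
  by_cases hij : i = j
  · by_cases hi : i = 0
    · simp [hij ▸ hi, hi]
      ring
    · simp [hij, hij ▸ hi]
      ring
  · simp only [hij, if_false]
    -- The dependence on the position is a common factor; the cancellation happens among the
    -- coefficients alone.
    generalize (if i.val = j.val + 3 ∧ j ≠ 0 then 1 else
      if j.val = i.val + 3 ∧ i ≠ 0 then -1 else 0 : ℤ) = s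
    simp
    ring

/-! ### The metric and the 4-form `*φ` -/

theorem exists_inv_diagonal {ι : Type*} [Fintype ι] [DecidableEq ι] (P : ι → Prop)
    [DecidablePred P] (s t : ℝ) : ∃ s' t' : ℝ,
      (Matrix.diagonal fun i => if P i then s else t)⁻¹ =
        Matrix.diagonal fun i => if P i then s' else t' := by
  rw [Matrix.inv_diagonal]
  by_cases h : IsUnit fun i => if P i then s else t
  · refine ⟨s⁻¹, t⁻¹, congrArg _ (funext fun i => ?_)⟩
    have h1 := congrFun (Ring.inverse_mul_cancel _ h) i
    rw [Pi.mul_apply, Pi.one_apply] at h1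
    rw [eq_inv_of_mul_eq_one_left h1]
    split_ifs <;> rfl
  -- A singular diagonal matrix has inverse 0 by convention, which still has the two-valued form. No
  -- nondegeneracy is therefore required.
  · refine ⟨0, 0, ?_⟩
    rw [Ring.inverse_non_unit _ h]
    simp

/-- The only fact about g_φ used later: it gives one weight to e₁ and a common weight to e₂, …, e₇.
The ninth-root normalisation never has to be computed. -/
theorem exists_gram_phi_inv (a b z : ℝ) : ∃ s t : ℝ, (gram (phi a b a b z))⁻¹ =
    Matrix.diagonal fun i => if i = 0 then s else t := by
  have h : ∀ c : ℝ, c • bil (phi a b a b z) = Matrix.diagonal fun i =>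
      if i = 0 then c * (6 * z ^ 3) else c * (6 * z * (a ^ 2 + b ^ 2)) := by
    intro c
    rw [bil_phi, ← Matrix.diagonal_smul]
    congr 1
    funext i
    simp
  rw [gram, h]
  exact exists_inv_diagonal _ _ _

theorem eUp_of_diagonal {φ : (Fin 3 → so 5) → ℝ} {w : Fin 7 → ℝ}
    (h : (gram φ)⁻¹ = Matrix.diagonal w) (i : Fin 7) : eUp φ i = w i • e (mIdx i) := by
  simp [eUp, h, Matrix.diagonal_apply]

theorem mIdx_injective : Function.Injective mIdx :=
  Fin.castLE_injective (by norm_num)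

theorem co_mIdx_eUp {φ : (Fin 3 → so 5) → ℝ} {w : Fin 7 → ℝ}
    (h : (gram φ)⁻¹ = Matrix.diagonal w) (i j : Fin 7) :
    co (mIdx i) (eUp φ j) = if i = j then w i else 0 := by
  rw [eUp_of_diagonal h, map_smul, co_e, smul_eq_mul]
  by_cases hij : i = j
  · simp [hij]
  · simp [hij, mIdx_injective.eq_iff]

theorem sum_coWedge_eUp {φ : (Fin 3 → so 5) → ℝ} {w : Fin 7 → ℝ}
    (h : (gram φ)⁻¹ = Matrix.diagonal w) {n : ℕ} (s : Fin (n + 1) → Fin 7) (f : Fin 7 → ℝ)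
    (v : Fin n → so 5) :
    ∑ i, f i * coWedge (fun l => mIdx (s l)) (Fin.cons (eUp φ i) v) =
      ∑ p : Fin (n + 1), (-1) ^ (p : ℕ) * w (s p) * f (s p) *
        coWedge (fun l => mIdx (s (p.succAbove l))) v := by
  simp only [coWedge_cons_right, co_mIdx_eUp h, Finset.mul_sum]
  rw [Finset.sum_comm]
  refine Finset.sum_congr rfl fun p _ => ?_
  simp only [mul_ite, ite_mul, mul_zero, zero_mul, Finset.sum_ite_eq, Finset.mem_univ, if_true]
  ring

/-- Each dual basis vector, inserted in the volume form, removes its own row up to a weight and a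
sign. Three insertions leave a sum over ordered triples of distinct indices, each with the wedge of
the complementary covectors. -/
theorem starForm_of_diagonal {φ : (Fin 3 → so 5) → ℝ} {w : Fin 7 → ℝ}
    (h : (gram φ)⁻¹ = Matrix.diagonal w) (v : Fin 4 → so 5) :
    starForm φ v = (1 / 6) * (Real.sign (bil φ).det * √(gram φ).det) *
      ∑ i : Fin 7, ∑ j : Fin 6, ∑ k : Fin 5,
        (-1) ^ ((i : ℕ) + j + k) * (w i * w (i.succAbove j) * w (i.succAbove (j.succAbove k))) *
        φ ![e (mIdx i), e (mIdx (i.succAbove j)), e (mIdx (i.succAbove (j.succAbove k)))] *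
        coWedge (fun l => mIdx (i.succAbove (j.succAbove (k.succAbove l)))) v := by
  have hv : ∀ X Y Z : so 5, ![X, Y, Z, v 0, v 1, v 2, v 3] =
      Fin.cons X (Fin.cons Y (Fin.cons Z v)) := by
    intro X Y Z
    ext1 l
    fin_cases l <;> rfl
  have hvol : ∀ i j k : Fin 7, volForm φ ![eUp φ i, eUp φ j, eUp φ k, v 0, v 1, v 2, v 3] =
      Real.sign (bil φ).det * √(gram φ).det * ((-1) ^ (i : ℕ) * w i *
        coWedge (fun l => mIdx (i.succAbove l)) (Fin.cons (eUp φ j) (Fin.cons (eUp φ k) v))) := by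
    intro i j k
    rw [volForm, hv]
    change _ * coWedge mIdx _ = _
    congr 1
    simp only [coWedge_cons_right mIdx, co_mIdx_eUp h]
    simp
  simp only [starForm, hvol, Finset.mul_sum]
  refine Finset.sum_congr rfl fun i _ => ?_
  trans ∑ k : Fin 7, ∑ j : Fin 7, (1 / 6 * (Real.sign (bil φ).det * √(gram φ).det) *
      ((-1) ^ (i : ℕ) * w i) * φ ![e (mIdx i), e (mIdx j), e (mIdx k)]) *
      coWedge (fun l => mIdx (i.succAbove l)) (Fin.cons (eUp φ j) (Fin.cons (eUp φ k) v))
  · rw [Finset.sum_comm]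
    refine Finset.sum_congr rfl fun k _ => Finset.sum_congr rfl fun j _ => ?_
    ring
  simp only [sum_coWedge_eUp h]
  rw [Finset.sum_comm]
  simp only [sum_coWedge_eUp h]
  refine Finset.sum_congr rfl fun j _ => Finset.sum_congr rfl fun k _ => ?_
  rw [pow_add, pow_add]
  ring

/-- The indices complementary to `i`, `i.succAbove j`, `i.succAbove (j.succAbove k)`. -/
def complRows (i : Fin 7) (j : Fin 6) (k : Fin 5) (l : Fin 4) : Fin 10 :=
  mIdx (i.succAbove (j.succAbove (k.succAbove l)))

/-- The indicator function of `complRows i j k = R`. -/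
def complDelta (R : Fin 4 → Fin 10) (i : Fin 7) (j : Fin 6) (k : Fin 5) : ℤ :=
  if complRows i j k = R then 1 else 0

/-- The Hodge star on monomials. The sign of the removals and the value of φ both alternate in the
triple, so their product depends only on the complementary indices. -/
theorem phiCoeff_eq_complDelta : ∀ (i : Fin 7) (j : Fin 6) (k : Fin 5),
    let p c := (-1) ^ ((i : ℕ) + j + k) *
      phiCoeff c i (i.succAbove j) (i.succAbove (j.succAbove k))
    let D R := complDelta R i j k
    p 0 = -(D ![2, 3, 5, 6] + D ![1, 3, 4, 6] + D ![1, 2, 4, 5]) ∧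
      p 1 = -(D ![0, 4, 5, 6] - D ![0, 2, 3, 4] + D ![0, 1, 3, 5] - D ![0, 1, 2, 6]) ∧
      p 2 = -(D ![0, 1, 2, 3] - D ![0, 1, 5, 6] + D ![0, 2, 4, 6] - D ![0, 3, 4, 5]) := by
  decide +kernel

/-- The index 0 is either exactly one of the three removed indices or the first of the complementary
ones, so the product of the three weights can be read off from the complement. -/
theorem complRows_cases : ∀ (i : Fin 7) (j : Fin 6) (k : Fin 5),
    (i = 0 ∧ i.succAbove j ≠ 0 ∧ i.succAbove (j.succAbove k) ≠ 0 ∧ complRows i j k 0 ≠ 0) ∨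
    (i ≠ 0 ∧ i.succAbove j = 0 ∧ i.succAbove (j.succAbove k) ≠ 0 ∧ complRows i j k 0 ≠ 0) ∨
    (i ≠ 0 ∧ i.succAbove j ≠ 0 ∧ i.succAbove (j.succAbove k) = 0 ∧ complRows i j k 0 ≠ 0) ∨
    (i ≠ 0 ∧ i.succAbove j ≠ 0 ∧ i.succAbove (j.succAbove k) ≠ 0 ∧ complRows i j k 0 = 0) := by
  decide +kernel

-- Each complement arises from the 3! orderings of the removed triple; this cancels the factor 1/6
-- of `starForm`.
set_option maxRecDepth 100000 in
theorem sum_complDelta : ∀ R ∈ [![2, 3, 5, 6], ![1, 3, 4, 6], ![1, 2, 4, 5], ![0, 4, 5, 6],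
      ![0, 2, 3, 4], ![0, 1, 3, 5], ![0, 1, 2, 6], ![0, 1, 2, 3], ![0, 1, 5, 6], ![0, 2, 4, 6],
      ![0, 3, 4, 5]], ∑ i, ∑ j, ∑ k, complDelta R i j k = 6 := by
  decide +kernel

theorem exists_starForm_phi (a b z : ℝ) : ∃ s t : ℝ, starForm (phi a b a b z) =
    s • (coWedge ![2, 3, 5, 6] + coWedge ![1, 3, 4, 6] + coWedge ![1, 2, 4, 5]) +
    (t * a) • (coWedge ![0, 4, 5, 6] - coWedge ![0, 2, 3, 4] + coWedge ![0, 1, 3, 5] -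
      coWedge ![0, 1, 2, 6]) +
    (t * b) • (coWedge ![0, 1, 2, 3] - coWedge ![0, 1, 5, 6] + coWedge ![0, 2, 4, 6] -
      coWedge ![0, 3, 4, 5]) := by
  obtain ⟨s, t, h⟩ := exists_gram_phi_inv a b z
  set K := Real.sign (bil (phi a b a b z)).det * √(gram (phi a b a b z)).det with hK
  -- The complement of a monomial without index 0 contains e₁ and contributes the weight s t²; that
  -- of a monomial with index 0 contributes t³. The sign comes from `phiCoeff_eq_complDelta`.
  refine ⟨-z * (s * t ^ 2) * K, - t ^ 3 * K, ?_⟩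
  funext v
  rw [starForm_of_diagonal h, ← hK]
  let w : Fin 7 → ℝ := fun i => if i = 0 then s else t
  let u (R : Fin 4 → Fin 10) : ℝ := (if R 0 = 0 then t ^ 3 else s * t ^ 2) * coWedge R v
  have hw : ∀ i j k, w i * w (i.succAbove j) * w (i.succAbove (j.succAbove k)) *
      coWedge (complRows i j k) v = u (complRows i j k) := by
    intro i j k
    simp only [w, u]
    rcases complRows_cases i j k with ⟨h1, h2, h3, h4⟩ | ⟨h1, h2, h3, h4⟩ | ⟨h1, h2, h3, h4⟩ |
      ⟨h1, h2, h3, h4⟩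
    · rw [if_pos h1, if_neg h2, if_neg h3, if_neg h4]
      ring
    · rw [if_neg h1, if_pos h2, if_neg h3, if_neg h4]
      ring
    · rw [if_neg h1, if_neg h2, if_pos h3, if_neg h4]
      ring
    · rw [if_neg h1, if_neg h2, if_neg h3, if_pos h4]
      ring
  have hu : ∀ R i j k, (complDelta R i j k : ℝ) * u (complRows i j k) =
      (complDelta R i j k : ℝ) * u R := by
    intro R i j k
    rw [complDelta]
    split_ifs with h
    · rw [h]
    · simp
  have key : ∀ (i : Fin 7) (j : Fin 6) (k : Fin 5), (-1) ^ ((i : ℕ) + j + k) *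
      (w i * w (i.succAbove j) * w (i.succAbove (j.succAbove k))) *
      phi a b a b z
        ![e (mIdx i), e (mIdx (i.succAbove j)), e (mIdx (i.succAbove (j.succAbove k)))] *
      coWedge (complRows i j k) v =
      (-z * (u ![2, 3, 5, 6])) * (complDelta ![2, 3, 5, 6] i j k : ℝ) +
      (-z * (u ![1, 3, 4, 6])) * (complDelta ![1, 3, 4, 6] i j k : ℝ) +
      (-z * (u ![1, 2, 4, 5])) * (complDelta ![1, 2, 4, 5] i j k : ℝ) +
      (-a * (u ![0, 4, 5, 6])) * (complDelta ![0, 4, 5, 6] i j k : ℝ) +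
      (a * (u ![0, 2, 3, 4])) * (complDelta ![0, 2, 3, 4] i j k : ℝ) +
      (-a * (u ![0, 1, 3, 5])) * (complDelta ![0, 1, 3, 5] i j k : ℝ) +
      (a * (u ![0, 1, 2, 6])) * (complDelta ![0, 1, 2, 6] i j k : ℝ) +
      (-b * (u ![0, 1, 2, 3])) * (complDelta ![0, 1, 2, 3] i j k : ℝ) +
      (b * (u ![0, 1, 5, 6])) * (complDelta ![0, 1, 5, 6] i j k : ℝ) +
      (-b * (u ![0, 2, 4, 6])) * (complDelta ![0, 2, 4, 6] i j k : ℝ) +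
      (b * (u ![0, 3, 4, 5])) * (complDelta ![0, 3, 4, 5] i j k : ℝ) := by
    intro i j k
    obtain ⟨h0, h1, h2⟩ := phiCoeff_eq_complDelta i j k
    have h0 := congrArg (Int.cast : ℤ → ℝ) h0
    have h1 := congrArg (Int.cast : ℤ → ℝ) h1
    have h2 := congrArg (Int.cast : ℤ → ℝ) h2
    push_cast at h0 h1 h2
    rw [phi_basis, Fin.sum_univ_three]
    simp only [Matrix.cons_val]
    have hu' := fun R => hu R i j k
    linear_combination (-1) ^ ((i : ℕ) + j + k) *
        (z * phiCoeff 0 i (i.succAbove j) (i.succAbove (j.succAbove k)) +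
        a * phiCoeff 1 i (i.succAbove j) (i.succAbove (j.succAbove k)) +
        b * phiCoeff 2 i (i.succAbove j) (i.succAbove (j.succAbove k))) * hw i j k +
      (z * h0 + a * h1 + b * h2) * u (complRows i j k) -
      z * (hu' ![2, 3, 5, 6] + hu' ![1, 3, 4, 6] + hu' ![1, 2, 4, 5]) -
      a * (hu' ![0, 4, 5, 6] - hu' ![0, 2, 3, 4] + hu' ![0, 1, 3, 5] - hu' ![0, 1, 2, 6]) -
      b * (hu' ![0, 1, 2, 3] - hu' ![0, 1, 5, 6] + hu' ![0, 2, 4, 6] - hu' ![0, 3, 4, 5])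
  change _ * (∑ i : Fin 7, ∑ j : Fin 6, ∑ k : Fin 5, (-1) ^ ((i : ℕ) + j + k) *
    (w i * w (i.succAbove j) * w (i.succAbove (j.succAbove k))) * _ *
    coWedge (complRows i j k) v) = _
  have hs : ∀ R : Fin 4 → Fin 10, ∑ i, ∑ j, ∑ k, complDelta R i j k = 6 →
      ∑ i, ∑ j, ∑ k, (complDelta R i j k : ℝ) = 6 := by
    intro R hR
    exact_mod_cast congrArg (Int.cast : ℤ → ℝ) hR
  simp only [key, Finset.sum_add_distrib, ← Finset.mul_sum]
  rw [hs _ (sum_complDelta _ (by simp)), hs _ (sum_complDelta _ (by simp)),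
    hs _ (sum_complDelta _ (by simp)), hs _ (sum_complDelta _ (by simp)),
    hs _ (sum_complDelta _ (by simp)), hs _ (sum_complDelta _ (by simp)),
    hs _ (sum_complDelta _ (by simp)), hs _ (sum_complDelta _ (by simp)),
    hs _ (sum_complDelta _ (by simp)), hs _ (sum_complDelta _ (by simp)),
    hs _ (sum_complDelta _ (by simp))]
  simp only [u, Pi.add_apply, Pi.sub_apply, Pi.smul_apply, smul_eq_mul]
  simp
  ring

/-! ### `φ` is coclosed -/

/-- The side condition orients the swap, so that repeated rewriting sorts the indices increasingly
and terminates. -/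
theorem coWedge_five_swap_0 {i j k l m : Fin 10} (_h : j < i) :
    coWedge ![i, j, k, l, m] = -coWedge ![j, i, k, l, m] := by
  funext v
  rw [coWedge_swap (i := 0) (j := 1) (by decide), Pi.neg_apply]
  congr 2
  funext p
  fin_cases p <;> rfl

theorem coWedge_five_eq_zero_0 (i k l m : Fin 10) : coWedge ![i, i, k, l, m] = 0 := by
  funext v
  exact coWedge_eq_zero (i := 0) (j := 1) (by decide) _ rfl v

theorem coWedge_five_swap_1 {i j k l m : Fin 10} (_h : k < j) :
    coWedge ![i, j, k, l, m] = -coWedge ![i, k, j, l, m] := by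
  funext v
  rw [coWedge_swap (i := 1) (j := 2) (by decide), Pi.neg_apply]
  congr 2
  funext p
  fin_cases p <;> rfl

theorem coWedge_five_eq_zero_1 (i j l m : Fin 10) : coWedge ![i, j, j, l, m] = 0 := by
  funext v
  exact coWedge_eq_zero (i := 1) (j := 2) (by decide) _ rfl v

theorem coWedge_five_swap_2 {i j k l m : Fin 10} (_h : l < k) :
    coWedge ![i, j, k, l, m] = -coWedge ![i, j, l, k, m] := by
  funext v
  rw [coWedge_swap (i := 2) (j := 3) (by decide), Pi.neg_apply]
  congr 2
  funext p
  fin_cases p <;> rfl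

theorem coWedge_five_eq_zero_2 (i j k m : Fin 10) : coWedge ![i, j, k, k, m] = 0 := by
  funext v
  exact coWedge_eq_zero (i := 2) (j := 3) (by decide) _ rfl v

theorem coWedge_five_swap_3 {i j k l m : Fin 10} (_h : m < l) :
    coWedge ![i, j, k, l, m] = -coWedge ![i, j, k, m, l] := by
  funext v
  rw [coWedge_swap (i := 3) (j := 4) (by decide), Pi.neg_apply]
  congr 2
  funext p
  fin_cases p <;> rfl

theorem coWedge_five_eq_zero_3 (i j k l : Fin 10) : coWedge ![i, j, k, l, l] = 0 := by
  funext v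
  exact coWedge_eq_zero (i := 3) (j := 4) (by decide) _ rfl v

theorem extD_const_coWedge_four (i j k l : Fin 7) (g : SO 5) (v : Fin 5 → so 5) :
    extD (fun _ => coWedge ![mIdx i, mIdx j, mIdx k, mIdx l]) g v =
      -wedge2 (coBracket i) (coWedge ![mIdx j, mIdx k, mIdx l]) v +
      wedge2 (coBracket j) (coWedge ![mIdx i, mIdx k, mIdx l]) v -
      wedge2 (coBracket k) (coWedge ![mIdx i, mIdx j, mIdx l]) v +
      wedge2 (coBracket l) (coWedge ![mIdx i, mIdx j, mIdx k]) v := by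
  have h : ∀ p : Fin 4, (fun r : Fin 3 => ![mIdx i, mIdx j, mIdx k, mIdx l] (p.succAbove r)) =
      ![![mIdx j, mIdx k, mIdx l], ![mIdx i, mIdx k, mIdx l], ![mIdx i, mIdx j, mIdx l],
        ![mIdx i, mIdx j, mIdx k]] p := by
    intro p
    funext r
    fin_cases p <;> fin_cases r <;> rfl
  rw [extD_const_coWedge, Fin.sum_univ_four, h, h, h, h]
  simp only [Matrix.cons_val, co_bracket]
  norm_num
  ring

theorem wedge2_coWedge_three (s t i j k : Fin 10) (v : Fin 5 → so 5) :
    wedge2 (coWedge ![s, t]) (coWedge ![i, j, k]) v = coWedge ![s, t, i, j, k] v :=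
  wedge2_coWedge s t _ v

/-- The form ω² is closed because ω = de¹. For Υ = Im((a - ib) Ω), d(e¹ ∧ Υ) = ω ∧ Υ - e¹ ∧ dΥ: the
first term vanishes by type, the second because dΥ is a multiple of e¹. The 𝔰𝔬(3)-terms of the
structure equations cancel as well. -/
theorem isCoclosed_phi (a b z : ℝ) : IsCoclosed (phi a b a b z) := by
  intro g v
  obtain ⟨s, t, h⟩ := exists_starForm_phi a b z
  -- The structure equations are stated for indices in `Fin 7`, the monomials use literals in `Fin
  -- 10`; the equations allow both to be given side by side.
  have h4 : ∀ i j k l : Fin 7, ∀ i' j' k' l' : Fin 10, mIdx i = i' → mIdx j = j' → mIdx k = k' →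
      mIdx l = l' → extD (fun _ => coWedge ![i', j', k', l']) g v =
      -wedge2 (coBracket i) (coWedge ![j', k', l']) v +
      wedge2 (coBracket j) (coWedge ![i', k', l']) v -
      wedge2 (coBracket k) (coWedge ![i', j', l']) v +
      wedge2 (coBracket l) (coWedge ![i', j', k']) v := by
    rintro i j k l _ _ _ _ rfl rfl rfl rfl
    exact extD_const_coWedge_four i j k l g v
  simp only [h, extD_const_add, extD_const_smul, sub_eq_add_neg, ← neg_one_smul ℝ (coWedge _)]
  rw [h4 2 3 5 6 2 3 5 6 rfl rfl rfl rfl, h4 1 3 4 6 1 3 4 6 rfl rfl rfl rfl,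
    h4 1 2 4 5 1 2 4 5 rfl rfl rfl rfl, h4 0 4 5 6 0 4 5 6 rfl rfl rfl rfl,
    h4 0 2 3 4 0 2 3 4 rfl rfl rfl rfl, h4 0 1 3 5 0 1 3 5 rfl rfl rfl rfl,
    h4 0 1 2 6 0 1 2 6 rfl rfl rfl rfl, h4 0 1 2 3 0 1 2 3 rfl rfl rfl rfl,
    h4 0 1 5 6 0 1 5 6 rfl rfl rfl rfl, h4 0 2 4 6 0 2 4 6 rfl rfl rfl rfl,
    h4 0 3 4 5 0 3 4 5 rfl rfl rfl rfl]
  simp only [coBracket, Matrix.cons_val, wedge2_add_left, wedge2_sub_left, wedge2_neg_left,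
    wedge2_coWedge_three]
  simp [coWedge_five_swap_0, coWedge_five_eq_zero_0, coWedge_five_swap_1, coWedge_five_eq_zero_1,
    coWedge_five_swap_2, coWedge_five_eq_zero_2, coWedge_five_swap_3, coWedge_five_eq_zero_3]
  ring

/-! ### The adjoint action of `SO(3)` -/

/-- The first two indices of `Fin 5`. -/
abbrev idxL (m : Fin 2) : Fin 5 := Fin.castAdd 3 m

/-- The last three indices of `Fin 5`. -/
abbrev idxR (p : Fin 3) : Fin 5 := Fin.natAdd 2 p

theorem sum_idx {M : Type*} [AddCommMonoid M] (F : Fin 5 → M) :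
    ∑ i, F i = ∑ m, F (idxL m) + ∑ p, F (idxR p) :=
  Fin.sum_univ_add (a := 2) (b := 3) F

section block

variable (u : Matrix (Fin 2) (Fin 2) ℝ) (s : Matrix (Fin 3) (Fin 3) ℝ)

theorem block_LL (m n : Fin 2) : block u s (idxL m) (idxL n) = u m n := by
  change Matrix.fromBlocks u 0 0 s (finSumFinEquiv.symm (Fin.castAdd 3 m : Fin (2 + 3)))
    (finSumFinEquiv.symm (Fin.castAdd 3 n : Fin (2 + 3))) = _
  simp only [finSumFinEquiv_symm_apply_castAdd]
  rfl

theorem block_LR (m : Fin 2) (p : Fin 3) : block u s (idxL m) (idxR p) = 0 := by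
  change Matrix.fromBlocks u 0 0 s (finSumFinEquiv.symm (Fin.castAdd 3 m : Fin (2 + 3)))
    (finSumFinEquiv.symm (Fin.natAdd 2 p : Fin (2 + 3))) = _
  simp only [finSumFinEquiv_symm_apply_castAdd, finSumFinEquiv_symm_apply_natAdd]
  rfl

theorem block_RL (m : Fin 2) (p : Fin 3) : block u s (idxR p) (idxL m) = 0 := by
  change Matrix.fromBlocks u 0 0 s (finSumFinEquiv.symm (Fin.natAdd 2 p : Fin (2 + 3)))
    (finSumFinEquiv.symm (Fin.castAdd 3 m : Fin (2 + 3))) = _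
  simp only [finSumFinEquiv_symm_apply_natAdd, finSumFinEquiv_symm_apply_castAdd]
  rfl

theorem block_RR (p q : Fin 3) : block u s (idxR p) (idxR q) = s p q := by
  change Matrix.fromBlocks u 0 0 s (finSumFinEquiv.symm (Fin.natAdd 2 p : Fin (2 + 3)))
    (finSumFinEquiv.symm (Fin.natAdd 2 q : Fin (2 + 3))) = _
  simp only [finSumFinEquiv_symm_apply_natAdd]
  rfl

end block

theorem Ad_apply (h : SO 5) (X : so 5) (i j : Fin 5) :
    (Ad h X).1 i j = ∑ l, (∑ k, h.1 i k * X.1 k l) * h.1 j l := by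
  change (h.1 * X.1 * (h⁻¹ : SO 5).1) i j = _
  rw [coe_inv_SO, Matrix.mul_apply]
  rfl

theorem incl_val (h : SO 3) : (incl h).1 = block 1 h.1 := rfl

/-- Under `SO(3)`, 𝔰𝔬(5) splits into a trivial line, two copies of the standard representation (the
rows of the off-diagonal block) and the adjoint representation. -/
theorem Ad_incl_LL (h : SO 3) (X : so 5) (m n : Fin 2) :
    (Ad (incl h) X).1 (idxL m) (idxL n) = X.1 (idxL m) (idxL n) := by
  simp [Ad_apply, incl_val, sum_idx, block_LL, block_LR, Matrix.one_apply, -Fin.natAdd_eq_addNat]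

theorem Ad_incl_LR (h : SO 3) (X : so 5) (m : Fin 2) (p : Fin 3) :
    (Ad (incl h) X).1 (idxL m) (idxR p) = ∑ q, h.1 p q * X.1 (idxL m) (idxR q) := by
  simp [Ad_apply, incl_val, sum_idx, block_LL, block_LR, block_RL, block_RR, Matrix.one_apply,
    -Fin.natAdd_eq_addNat, mul_comm]

theorem Ad_incl_RR (h : SO 3) (X : so 5) (p q : Fin 3) :
    (Ad (incl h) X).1 (idxR p) (idxR q) =
      ∑ r, (∑ t, h.1 p t * X.1 (idxR t) (idxR r)) * h.1 q r := by
  simp [Ad_apply, incl_val, sum_idx, block_RL, block_RR, -Fin.natAdd_eq_addNat]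

/-! ### The connection `α` and its curvature -/

theorem alpha_apply (g : SO 5) (X : so 5) (p q : Fin 3) :
    (alpha g X).1 p q = X.1 (idxR p) (idxR q) := by
  have h : (alpha g X).1 = ∑ i : Fin 3, co (Fin.natAdd 7 i) X • (f i).1 := by
    simp [alpha]
  rw [h, Matrix.sum_apply, Fin.sum_univ_three]
  simp only [Matrix.smul_apply, f, Matrix.sub_apply, Matrix.single_apply, co_apply, smul_eq_mul]
  fin_cases p <;> fin_cases q <;> simp [pos, Fin.natAdd, idxR, so_apply_self]
  all_goals rw [so_apply_swap, neg_neg]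

theorem alpha_lieIncl (g : SO 5) (s : so 3) : alpha g (lieIncl s) = s := by
  apply Subtype.ext
  ext p q
  rw [alpha_apply]
  exact block_RR _ _ _ _

theorem alpha_Ad (h : SO 3) (g : SO 5) (X : so 5) :
    (alpha g (Ad (incl h) X)).1 = h.1 * (alpha g X).1 * (h.1)ᵀ := by
  ext p q
  simp only [alpha_apply, Ad_incl_RR, Matrix.mul_apply, Matrix.transpose_apply]

theorem isConnection_alpha : IsConnection alpha where
  smooth X p q := ⟨fun _ => (alpha 1 X).1 p q, contDiff_const, fun _ => rfl⟩
  equivariant h g X := by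
    have h1 := transpose_mul_SO h
    rw [alpha_Ad, coe_inv_SO]
    change (alpha g X).1 = _
    calc (alpha g X).1 = ((h.1)ᵀ * h.1) * (alpha g X).1 * ((h.1)ᵀ * h.1) := by
          rw [h1, one_mul, mul_one]
      _ = _ := by simp only [mul_assoc]
  vertical := alpha_lieIncl

theorem isInvariantConnection_alpha : IsInvariantConnection alpha :=
  ⟨isConnection_alpha, fun _ _ => rfl⟩

theorem dOne_apply (A : OneForm) (g : SO 5) (v : Fin 2 → so 5) (p q : Fin 3) :
    dOne A g v p q = lieD (v 0) (fun g' => (A g' (v 1)).1 p q) g -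
      lieD (v 1) (fun g' => (A g' (v 0)).1 p q) g - (A g ⁅v 0, v 1⁆).1 p q := by
  simp [dOne, extD, Fin.sum_univ_two, Fin.removeNth]
  ring

/-- The indices of the entries `(m, p + 2)` in the basis of `𝔰𝔬(5)`. -/
def hIdx (m : Fin 2) (p : Fin 3) : Fin 10 := ![![1, 2, 3], ![4, 5, 6]] m p

theorem co_hIdx (m : Fin 2) (p : Fin 3) (X : so 5) : co (hIdx m p) X = X.1 (idxL m) (idxR p) := by
  fin_cases m <;> fin_cases p <;> rfl

/-- As α is the projection to the lower block, F_α(X, Y) = [αX, αY] - α[X, Y]. The products inside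
the lower block cancel, leaving the contribution of the 𝔪-components. -/
theorem curvature_alpha (g : SO 5) (v : Fin 2 → so 5) (p q : Fin 3) :
    curvature alpha g v p q = ∑ m, coWedge ![hIdx m p, hIdx m q] v := by
  simp only [curvature, Matrix.add_apply, Matrix.sub_apply, dOne_apply, alpha_apply, lieD_const,
    Matrix.mul_apply, so_bracket_apply, sum_idx, coWedge_pair, co_hIdx, Finset.sum_sub_distrib]
  simp only [so_apply_swap _ (idxL _) (idxR _), neg_mul, Finset.sum_neg_distrib]
  ring

/-! ### The instanton equation -/

theorem coWedge_six_swap_0 {i j k l m n : Fin 10} (_h : j < i) :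
    coWedge ![i, j, k, l, m, n] = -coWedge ![j, i, k, l, m, n] := by
  funext v
  rw [coWedge_swap (i := 0) (j := 1) (by decide), Pi.neg_apply]
  congr 2
  funext p
  fin_cases p <;> rfl

theorem coWedge_six_eq_zero_0 (i k l m n : Fin 10) : coWedge ![i, i, k, l, m, n] = 0 := by
  funext v
  exact coWedge_eq_zero (i := 0) (j := 1) (by decide) _ rfl v

theorem coWedge_six_swap_1 {i j k l m n : Fin 10} (_h : k < j) :
    coWedge ![i, j, k, l, m, n] = -coWedge ![i, k, j, l, m, n] := by
  funext v
  rw [coWedge_swap (i := 1) (j := 2) (by decide), Pi.neg_apply]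
  congr 2
  funext p
  fin_cases p <;> rfl

theorem coWedge_six_eq_zero_1 (i j l m n : Fin 10) : coWedge ![i, j, j, l, m, n] = 0 := by
  funext v
  exact coWedge_eq_zero (i := 1) (j := 2) (by decide) _ rfl v

theorem coWedge_six_swap_2 {i j k l m n : Fin 10} (_h : l < k) :
    coWedge ![i, j, k, l, m, n] = -coWedge ![i, j, l, k, m, n] := by
  funext v
  rw [coWedge_swap (i := 2) (j := 3) (by decide), Pi.neg_apply]
  congr 2
  funext p
  fin_cases p <;> rfl

theorem coWedge_six_eq_zero_2 (i j k m n : Fin 10) : coWedge ![i, j, k, k, m, n] = 0 := by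
  funext v
  exact coWedge_eq_zero (i := 2) (j := 3) (by decide) _ rfl v

theorem coWedge_six_swap_3 {i j k l m n : Fin 10} (_h : m < l) :
    coWedge ![i, j, k, l, m, n] = -coWedge ![i, j, k, m, l, n] := by
  funext v
  rw [coWedge_swap (i := 3) (j := 4) (by decide), Pi.neg_apply]
  congr 2
  funext p
  fin_cases p <;> rfl

theorem coWedge_six_eq_zero_3 (i j k l n : Fin 10) : coWedge ![i, j, k, l, l, n] = 0 := by
  funext v
  exact coWedge_eq_zero (i := 3) (j := 4) (by decide) _ rfl v

theorem coWedge_six_swap_4 {i j k l m n : Fin 10} (_h : n < m) :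
    coWedge ![i, j, k, l, m, n] = -coWedge ![i, j, k, l, n, m] := by
  funext v
  rw [coWedge_swap (i := 4) (j := 5) (by decide), Pi.neg_apply]
  congr 2
  funext p
  fin_cases p <;> rfl

theorem coWedge_six_eq_zero_4 (i j k l m : Fin 10) : coWedge ![i, j, k, l, m, m] = 0 := by
  funext v
  exact coWedge_eq_zero (i := 4) (j := 5) (by decide) _ rfl v

theorem wedge2_matrix_apply {k : ℕ} (F : (Fin 2 → so 5) → Matrix (Fin 3) (Fin 3) ℝ)
    (η : (Fin k → so 5) → ℝ) (v : Fin (k + 2) → so 5) (p q : Fin 3) :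
    wedge2 F η v p q = wedge2 (fun w => F w p q) η v := by
  simp only [wedge2, Matrix.sum_apply]
  refine Finset.sum_congr rfl fun j _ => Finset.sum_congr rfl fun i _ => ?_
  split_ifs <;> simp

theorem wedge2_coWedge_four (s t i j k l : Fin 10) (v : Fin 6 → so 5) :
    wedge2 (coWedge ![s, t]) (coWedge ![i, j, k, l]) v = coWedge ![s, t, i, j, k, l] v :=
  wedge2_coWedge s t _ v

/-- The curvature entries are of type (1,1), so they wedge to zero with Ω, and primitive, so they
wedge to zero with ω²; these are the two kinds of terms in *φ. -/
theorem isG2Instanton_alpha (a b z : ℝ) : IsG2Instanton (phi a b a b z) alpha := by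
  refine ⟨isConnection_alpha, fun g v => ?_⟩
  obtain ⟨s, t, h⟩ := exists_starForm_phi a b z
  ext p q
  have hF : (fun w => curvature alpha g w p q) =
      coWedge ![hIdx 0 p, hIdx 0 q] + coWedge ![hIdx 1 p, hIdx 1 q] := by
    funext w
    rw [curvature_alpha, Fin.sum_univ_two, Pi.add_apply]
  rw [wedge2_matrix_apply, hF, h]
  simp only [sub_eq_add_neg, ← neg_one_smul ℝ (coWedge _), wedge2_add_left, wedge2_add_right,
    wedge2_smul_right, wedge2_coWedge_four]
  fin_cases p <;> fin_cases q <;>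
    simp [hIdx, coWedge_six_swap_0, coWedge_six_eq_zero_0, coWedge_six_swap_1,
      coWedge_six_eq_zero_1, coWedge_six_swap_2, coWedge_six_eq_zero_2, coWedge_six_swap_3,
      coWedge_six_eq_zero_3, coWedge_six_swap_4, coWedge_six_eq_zero_4]

/-! ### `φ` is an invariant `G₂`-structure -/

theorem co_lieIncl (i : Fin 7) (s : so 3) : co (mIdx i) (lieIncl s) = 0 := by
  change block 0 s.1 (pos (mIdx i)).1 (pos (mIdx i)).2 = 0
  fin_cases i
  · exact block_LL 0 s.1 0 1
  · exact block_LR 0 s.1 0 0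
  · exact block_LR 0 s.1 0 1
  · exact block_LR 0 s.1 0 2
  · exact block_LR 0 s.1 1 0
  · exact block_LR 0 s.1 1 1
  · exact block_LR 0 s.1 1 2

theorem coWedge_horizontal {n : ℕ} (r : Fin n → Fin 7) (v : Fin n → so 5) (i : Fin n) (s : so 3)
    (h : v i = lieIncl s) : coWedge (fun l => mIdx (r l)) v = 0 := by
  refine Matrix.det_eq_zero_of_column_eq_zero i fun p => ?_
  rw [Matrix.of_apply, h, co_lieIncl]

/-- The complex coordinates of the horizontal part of an element of `𝔰𝔬(5)`. -/
noncomputable def cplx (X : so 5) (p : Fin 3) : ℂ :=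
  ⟨X.1 (idxL 0) (idxR p), X.1 (idxL 1) (idxR p)⟩

/-- The Kähler form on the horizontal part of `𝔰𝔬(5)`. -/
noncomputable def kahler (X Y : so 5) : ℝ :=
  ∑ p, (X.1 (idxL 0) (idxR p) * Y.1 (idxL 1) (idxR p) -
    Y.1 (idxL 0) (idxR p) * X.1 (idxL 1) (idxR p))

/-- This form makes invariance visible: a real rotation preserves `kahler`, and it multiplies the
complex determinant by its own determinant, which is 1. -/
theorem phi_eq_complex (a b z : ℝ) (v : Fin 3 → so 5) : phi a b a b z v =
    -z * (co 0 (v 0) * kahler (v 1) (v 2) - co 0 (v 1) * kahler (v 0) (v 2) +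
      co 0 (v 2) * kahler (v 0) (v 1)) +
    ((⟨a, -b⟩ : ℂ) * (Matrix.of fun p s => cplx (v s) p).det).re := by
  rw [phi_eq]
  simp only [Pi.add_apply, Pi.sub_apply, Pi.smul_apply, coWedge, Matrix.det_fin_three,
    Matrix.of_apply, Matrix.cons_val, kahler, cplx, Fin.sum_univ_three, smul_eq_mul,
    Complex.mul_re, Complex.mul_im, Complex.add_re, Complex.add_im, Complex.sub_re, Complex.sub_im,
    ← co_hIdx, hIdx]
  ring

theorem cplx_Ad (h : SO 3) (X : so 5) (p : Fin 3) :
    cplx (Ad (incl h) X) p = ∑ q, (h.1 p q : ℂ) * cplx X q := by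
  apply Complex.ext
  · simp [cplx, Ad_incl_LR, -Fin.natAdd_eq_addNat]
  · simp [cplx, Ad_incl_LR, -Fin.natAdd_eq_addNat]

theorem sum_mul_SO (h : SO 3) (x y : Fin 3 → ℝ) :
    ∑ p, (∑ q, h.1 p q * x q) * ∑ q, h.1 p q * y q = ∑ p, x p * y p := by
  change (h.1 *ᵥ x) ⬝ᵥ (h.1 *ᵥ y) = x ⬝ᵥ y
  rw [Matrix.dotProduct_mulVec, ← Matrix.mulVec_transpose, Matrix.mulVec_mulVec,
    transpose_mul_SO, Matrix.one_mulVec]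

theorem kahler_Ad (h : SO 3) (X Y : so 5) :
    kahler (Ad (incl h) X) (Ad (incl h) Y) = kahler X Y := by
  simp only [kahler, Ad_incl_LR, Finset.sum_sub_distrib, sum_mul_SO]

theorem co_zero_Ad (h : SO 3) (X : so 5) : co 0 (Ad (incl h) X) = co 0 X :=
  Ad_incl_LL h X 0 1

theorem phi_Ad (a b z : ℝ) (h : SO 3) (v : Fin 3 → so 5) :
    phi a b a b z (fun i => Ad (incl h) (v i)) = phi a b a b z v := by
  have hM : (Matrix.of fun p s => cplx (Ad (incl h) (v s)) p) =
      (h.1.map (algebraMap ℝ ℂ)) * Matrix.of fun p s => cplx (v s) p := by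
    ext p s
    simp [cplx_Ad, Matrix.mul_apply]
  have hd : (h.1.map (algebraMap ℝ ℂ)).det = 1 := by
    have := (algebraMap ℝ ℂ).map_det h.1
    rw [(Matrix.mem_specialOrthogonalGroup_iff.1 h.2).2, map_one] at this
    exact this.symm
  simp only [phi_eq_complex, kahler_Ad, co_zero_Ad, hM, Matrix.det_mul, hd, one_mul]

/-- Here p + iq is a cube root w of a - ib. Replacing ζ_p by w ζ_p turns (a - ib) Ω into the
standard complex volume form; `coframe` lists the real and imaginary parts of the w ζ_p. -/
theorem exists_cube_root (a b : ℝ) : ∃ p q : ℝ, a = p ^ 3 - 3 * p * q ^ 2 ∧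
    b = q ^ 3 - 3 * p ^ 2 * q := by
  obtain ⟨w, hw⟩ := IsAlgClosed.exists_pow_nat_eq (⟨a, -b⟩ : ℂ) (n := 3) (by norm_num)
  refine ⟨w.re, w.im, ?_, ?_⟩
  · have := congrArg Complex.re hw
    simp [pow_succ] at this
    linarith
  · have := congrArg Complex.im hw
    simp [pow_succ] at this
    linarith

/-- A coframe in which `φ` is the standard 3-form. -/
noncomputable def coframe (c p q : ℝ) : Fin 7 → so 5 →ₗ[ℝ] ℝ :=
  ![c • co 0, p • co 1 - q • co 4, p • co 2 - q • co 5, p • co 3 - q • co 6,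
    q • co 1 + p • co 4, q • co 2 + p • co 5, q • co 3 + p • co 6]

theorem linearIndependent_coframe {c p q : ℝ} (hc : c ≠ 0) (h : p ^ 2 + q ^ 2 ≠ 0) :
    LinearIndependent ℝ (coframe c p q) := by
  rw [Fintype.linearIndependent_iff]
  intro k hk
  have h' : ∀ i, ∑ j, k j * coframe c p q j (e i) = 0 := fun i => by
    simpa using congrArg (fun θ : so 5 →ₗ[ℝ] ℝ => θ (e i)) hk
  -- The two equations say (x + iy)(p - iq) = 0.
  have key : ∀ x y : ℝ, x * p + y * q = 0 → y * p - x * q = 0 → x = 0 ∧ y = 0 := by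
    intro x y h1 h2
    refine ⟨?_, ?_⟩
    · refine (mul_eq_zero.1 (?_ : x * (p ^ 2 + q ^ 2) = 0)).resolve_right h
      linear_combination p * h1 - q * h2
    · refine (mul_eq_zero.1 (?_ : y * (p ^ 2 + q ^ 2) = 0)).resolve_right h
      linear_combination q * h1 + p * h2
  have h0 := h' 0
  have h1 := h' 1
  have h2 := h' 2
  have h3 := h' 3
  have h4 := h' 4
  have h5 := h' 5
  have h6 := h' 6
  simp [coframe, Fin.sum_univ_seven, co_e] at h0 h1 h2 h3 h4 h5 h6
  obtain ⟨h1, h4⟩ := key (k 1) (k 4) (by linarith) (by linarith)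
  obtain ⟨h2, h5⟩ := key (k 2) (k 5) (by linarith) (by linarith)
  obtain ⟨h3, h6⟩ := key (k 3) (k 6) (by linarith) (by linarith)
  intro i
  fin_cases i
  · exact h0.resolve_right hc
  all_goals assumption

theorem isInvariantG2Structure_phi {a b z : ℝ} (hz : z ≠ 0) (hab : a ^ 2 + b ^ 2 ≠ 0) :
    IsInvariantG2Structure (phi a b a b z) where
  horizontal v i := by
    rintro ⟨s, hs⟩
    have h3 : ∀ j k l : Fin 7, ∀ j' k' l' : Fin 10, mIdx j = j' → mIdx k = k' → mIdx l = l' →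
        coWedge ![j', k', l'] v = 0 := by
      rintro j k l _ _ _ rfl rfl rfl
      rw [← coWedge_horizontal ![j, k, l] v i s hs]
      congr 1
      ext1 p
      fin_cases p <;> rfl
    rw [phi_eq]
    simp only [Pi.add_apply, Pi.sub_apply, Pi.smul_apply]
    rw [h3 0 1 4 0 1 4 rfl rfl rfl, h3 0 2 5 0 2 5 rfl rfl rfl, h3 0 3 6 0 3 6 rfl rfl rfl,
      h3 1 2 3 1 2 3 rfl rfl rfl, h3 1 5 6 1 5 6 rfl rfl rfl, h3 2 4 6 2 4 6 rfl rfl rfl,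
      h3 3 4 5 3 4 5 rfl rfl rfl, h3 1 2 6 1 2 6 rfl rfl rfl, h3 1 3 5 1 3 5 rfl rfl rfl,
      h3 2 3 4 2 3 4 rfl rfl rfl, h3 4 5 6 4 5 6 rfl rfl rfl]
    simp
  invariant h v := phi_Ad a b z h v
  coframe := by
    obtain ⟨p, q, rfl, rfl⟩ := exists_cube_root a b
    have hpq : p ^ 2 + q ^ 2 ≠ 0 := by
      intro h
      have hp : p = 0 := by nlinarith [sq_nonneg p, sq_nonneg q]
      have hq : q = 0 := by nlinarith [sq_nonneg p, sq_nonneg q]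
      simp [hp, hq] at hab
    -- Multiplying the ζ_p by w = p + iq scales ω by p² + q², so e¹ must be scaled by this constant
    -- to recover -z e¹ ∧ ω.
    have hc : -z / (p ^ 2 + q ^ 2) ≠ 0 := div_ne_zero (neg_ne_zero.2 hz) hpq
    refine ⟨coframe (-z / (p ^ 2 + q ^ 2)) p q, linearIndependent_coframe hc hpq, ?_, ?_⟩
    · intro i s
      have h0 : ∀ j : Fin 7, ∀ j' : Fin 10, mIdx j = j' → co j' (lieIncl s) = 0 := by
        rintro j _ rfl
        exact co_lieIncl j s
      fin_cases i <;> simp [coframe, h0 0 0 rfl, h0 1 1 rfl, h0 2 2 rfl, h0 3 3 rfl, h0 4 4 rfl,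
        h0 5 5 rfl, h0 6 6 rfl]
    · intro v
      obtain ⟨c, hc, hcz⟩ : ∃ c, c = -z / (p ^ 2 + q ^ 2) ∧ -z = c * (p ^ 2 + q ^ 2) :=
        ⟨_, rfl, by field_simp⟩
      rw [← hc, phi]
      simp only [coframe, Matrix.cons_val]
      simp only [wedge3, Matrix.det_fin_three, Matrix.of_apply, Matrix.cons_val,
        LinearMap.add_apply, LinearMap.sub_apply, LinearMap.smul_apply, smul_eq_mul, hcz]
      ring

/-! ### Left-invariant derivatives -/

/-- The matrix entries of an element of `SO(5)`. -/
def entries (M : Matrix (Fin 5) (Fin 5) ℝ) : Fin 5 → Fin 5 → ℝ := fun i j => M i j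

theorem hasDerivAt_exp_smul_entry (X : Matrix (Fin 5) (Fin 5) ℝ) (t : ℝ) (i j : Fin 5) :
    HasDerivAt (fun s : ℝ => NormedSpace.exp (s • X) i j)
      ((NormedSpace.exp (t • X) * X) i j) t := by
  -- Any norm serves here: the conclusion concerns single entries, and entries are continuous linear
  -- in finite dimension.
  let _ : NormedRing (Matrix (Fin 5) (Fin 5) ℝ) := Matrix.linftyOpNormedRing
  let _ : NormedAlgebra ℝ (Matrix (Fin 5) (Fin 5) ℝ) := Matrix.linftyOpNormedAlgebra
  have h := hasDerivAt_exp_smul_const (𝕂 := ℝ) X t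
  let ev : Matrix (Fin 5) (Fin 5) ℝ →ₗ[ℝ] ℝ := Matrix.entryLinearMap ℝ ℝ i j
  have h2 := (LinearMap.toContinuousLinearMap ev).hasFDerivAt.comp_hasDerivAt t h
  exact h2

theorem expSO_zero : expSO 0 = 1 := by
  apply Subtype.ext
  change NormedSpace.exp (0 : Matrix (Fin 5) (Fin 5) ℝ) = 1
  exact NormedSpace.exp_zero

theorem expSO_smul_Ad (k : SO 5) (X : so 5) (t : ℝ) :
    expSO (t • Ad k X) = k * expSO (t • X) * k⁻¹ := by
  apply Subtype.ext
  change NormedSpace.exp (t • (k.1 * X.1 * (k⁻¹ : SO 5).1)) =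
    k.1 * NormedSpace.exp (t • X.1) * (k⁻¹ : SO 5).1
  have hk : (k⁻¹ : SO 5).1 = (k.1)⁻¹ := by
    rw [coe_inv_SO]
    exact (Matrix.inv_eq_left_inv (transpose_mul_SO k)).symm
  have hu : IsUnit k.1 := IsUnit.of_mul_eq_one_right (k.1)ᵀ (transpose_mul_SO k)
  rw [hk, ← Matrix.exp_conj _ _ hu, Matrix.mul_smul, Matrix.smul_mul]

theorem hasDerivAt_entries_mul_expSO (g : SO 5) (X : so 5) (t : ℝ) :
    HasDerivAt (fun s : ℝ => entries (g * expSO (s • X)).1)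
      (entries ((g * expSO (t • X)).1 * X.1)) t := by
  rw [hasDerivAt_pi]
  intro i
  rw [hasDerivAt_pi]
  intro j
  have h := HasDerivAt.fun_sum (u := Finset.univ) fun k _ =>
    (hasDerivAt_exp_smul_entry X.1 t k j).const_mul (g.1 i k)
  have he : entries ((g * expSO (t • X)).1 * X.1) i j =
      ∑ k, g.1 i k * (NormedSpace.exp (t • X.1) * X.1) k j := by
    change (g.1 * NormedSpace.exp (t • X.1) * X.1) i j = _
    rw [Matrix.mul_assoc]
    rfl
  rw [he]
  exact h

/-- The differential of an ambient extension gives a continuous covector field L. Linearity of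
`lieD` in the field and continuity in the point are both read off from it. -/
theorem Smooth.exists_fderiv {h : SO 5 → ℝ} (hh : Smooth h) : Continuous h ∧
    ∃ L : (SO 5) → (Fin 5 → Fin 5 → ℝ) →L[ℝ] ℝ, Continuous L ∧
    ∀ g X t, HasDerivAt (fun s : ℝ => h (g * expSO (s • X)))
      (L (g * expSO (t • X)) (entries ((g * expSO (t • X)).1 * X.1))) t := by
  obtain ⟨H, hH, hHh⟩ := hh
  have hc : Continuous fun g : SO 5 => entries g.1 := continuous_subtype_val
  have he : h = fun g => H (entries g.1) := funext hHh
  refine ⟨he ▸ hH.continuous.comp hc, fun g => fderiv ℝ H (entries g.1),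
    (hH.continuous_fderiv (by simp)).comp hc, fun g X t => ?_⟩
  rw [he]
  exact ((hH.differentiable (by simp)).differentiableAt.hasFDerivAt).comp_hasDerivAt t
    (hasDerivAt_entries_mul_expSO g X t)

theorem Smooth.continuous {h : SO 5 → ℝ} (hh : Smooth h) : Continuous h :=
  hh.exists_fderiv.1

theorem lieD_eq_of_hasDerivAt {X : so 5} {h : SO 5 → ℝ} {g : SO 5} {c : ℝ}
    (H : HasDerivAt (fun s : ℝ => h (g * expSO (s • X))) c 0) : lieD X h g = c := H.deriv

theorem expSO_zero_smul (X : so 5) : expSO ((0 : ℝ) • X) = 1 := by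
  rw [zero_smul, expSO_zero]

theorem Smooth.hasDerivAt {h : SO 5 → ℝ} (hh : Smooth h) (g : SO 5) (X : so 5) (t : ℝ) :
    HasDerivAt (fun s : ℝ => h (g * expSO (s • X))) (lieD X h (g * expSO (t • X))) t := by
  obtain ⟨L, -, hL⟩ := hh.exists_fderiv.2
  convert hL g X t using 1
  refine lieD_eq_of_hasDerivAt ?_
  have := hL (g * expSO (t • X)) X 0
  rwa [expSO_zero_smul, mul_one] at this

theorem Smooth.hasDerivAt_zero {h : SO 5 → ℝ} (hh : Smooth h) (g : SO 5) (X : so 5) :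
    HasDerivAt (fun s : ℝ => h (g * expSO (s • X))) (lieD X h g) 0 := by
  have := hh.hasDerivAt g X 0
  rwa [expSO_zero_smul, mul_one] at this

theorem Smooth.lieD_eq {h : SO 5 → ℝ} (hh : Smooth h) :
    ∃ L : (SO 5) → (Fin 5 → Fin 5 → ℝ) →L[ℝ] ℝ, Continuous L ∧
    ∀ g X, lieD X h g = L g (entries (g.1 * X.1)) := by
  obtain ⟨L, hc, hL⟩ := hh.exists_fderiv.2
  refine ⟨L, hc, fun g X => lieD_eq_of_hasDerivAt ?_⟩
  have := hL g X 0
  rwa [expSO_zero_smul, mul_one] at this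

theorem Smooth.continuous_lieD {h : SO 5 → ℝ} (hh : Smooth h) (X : so 5) :
    Continuous (lieD X h) := by
  obtain ⟨L, hc, hL⟩ := hh.lieD_eq
  rw [show lieD X h = fun g => L g (entries (g.1 * X.1)) from funext fun g => hL g X]
  refine hc.clm_apply ?_
  have : Continuous fun g : SO 5 => g.1 * X.1 := continuous_subtype_val.mul continuous_const
  exact this

theorem Smooth.lieD_add {h : SO 5 → ℝ} (hh : Smooth h) (X Y : so 5) (g : SO 5) :
    lieD (X + Y) h g = lieD X h g + lieD Y h g := by
  obtain ⟨L, -, hL⟩ := hh.lieD_eq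
  rw [hL, hL, hL, ← map_add]
  congr 1
  change entries (g.1 * (X.1 + Y.1)) = _
  rw [mul_add]
  rfl

theorem Smooth.lieD_smul {h : SO 5 → ℝ} (hh : Smooth h) (c : ℝ) (X : so 5) (g : SO 5) :
    lieD (c • X) h g = c * lieD X h g := by
  obtain ⟨L, -, hL⟩ := hh.lieD_eq
  rw [hL, hL]
  refine Eq.trans (congrArg (L g) ?_) ((L g).map_smul c _)
  change entries (g.1 * (c • X.1)) = _
  rw [Matrix.mul_smul]
  rfl

theorem lieD_const_add_mul {h : SO 5 → ℝ} (hh : Smooth h) (c t : ℝ) (X : so 5) (g : SO 5) :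
    lieD X (fun g' => c + t * h g') g = t * lieD X h g :=
  lieD_eq_of_hasDerivAt (((hh.hasDerivAt_zero g X).const_mul t).const_add c)

/-- Uses k exp(tX) k⁻¹ = exp(t Ad(k) X). This is the source of the equivariance of exterior
derivatives. -/
theorem lieD_mul_right (X : so 5) (h : SO 5 → ℝ) (g k : SO 5) :
    lieD X h (g * k) = lieD (Ad k X) (fun g' => h (g' * k)) g := by
  simp only [lieD, expSO_smul_Ad]
  simp [mul_assoc]

/-! ### Integration over `SO(5)` -/

/-- The normalised Haar measure of `SO(5)`. -/
noncomputable abbrev haarSO : Measure (SO 5) :=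
  Measure.haarMeasure (⊤ : TopologicalSpace.PositiveCompacts (SO 5))

instance : IsProbabilityMeasure haarSO :=
  ⟨Measure.haarMeasure_self⟩

/-- A right translate of Haar measure is again a left-invariant probability measure, so by
uniqueness on the compact group it is the same measure. -/
instance : haarSO.IsMulRightInvariant where
  map_mul_right_eq_self k := by
    have hp : IsProbabilityMeasure (haarSO.map (· * k)) :=
      Measure.isProbabilityMeasure_map (measurable_mul_const k).aemeasurable
    have h := Measure.isMulInvariant_eq_smul_of_compactSpace (haarSO.map (· * k)) haarSO
    have h1 := congrArg (fun μ : Measure (SO 5) => μ Set.univ) h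
    simp only [measure_univ, Measure.smul_apply] at h1
    rw [h]
    have : Measure.haarScalarFactor (haarSO.map (· * k)) haarSO = 1 := by
      simpa [ENNReal.smul_def] using h1.symm
    rw [this, one_smul]

theorem integrable_of_continuous {h : SO 5 → ℝ} (hh : Continuous h) : Integrable h haarSO :=
  hh.integrable_of_hasCompactSupport (HasCompactSupport.of_compactSpace h)

/-- The flow of a left-invariant field is right translation, so t ↦ ∫ h(g exp(tX)) is constant.
Compactness bounds the derivative and permits differentiation under the integral. -/
theorem integral_lieD {h : SO 5 → ℝ} (hh : Smooth h) (X : so 5) :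
    ∫ g, lieD X h g ∂haarSO = 0 := by
  obtain ⟨C, hC⟩ : ∃ C, ∀ g, ‖lieD X h g‖ ≤ C := by
    obtain ⟨C, hC⟩ :=
      isCompact_univ.exists_bound_of_continuousOn (hh.continuous_lieD X).continuousOn
    exact ⟨C, fun g => hC g trivial⟩
  have h1 := (hasDerivAt_integral_of_dominated_loc_of_deriv_le (μ := haarSO) (x₀ := (0 : ℝ))
    (F := fun t g => h (g * expSO (t • X))) (F' := fun t g => lieD X h (g * expSO (t • X)))
    (bound := fun _ => C) Filter.univ_mem
    (Filter.Eventually.of_forall fun t =>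
      (hh.continuous.comp (continuous_mul_const _)).aestronglyMeasurable)
    (integrable_of_continuous (hh.continuous.comp (continuous_mul_const _)))
    ((hh.continuous_lieD X).comp (continuous_mul_const _)).aestronglyMeasurable
    (Filter.Eventually.of_forall fun g t _ => hC _) (integrable_const _)
    (Filter.Eventually.of_forall fun g t _ => hh.hasDerivAt g X t)).2
  simp only [integral_mul_right_eq_self (μ := haarSO) h,
    integral_mul_right_eq_self (μ := haarSO) (lieD X h)] at h1
  exact h1.unique (hasDerivAt_const _ _)

/-! ### Matrix-valued 2-forms on `V^{5,2}` with values in the adjoint bundle -/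

/-- Bilinear forms on the tangent bundle of `SO(5)` which are equivariant under `SO(3)`. -/
structure IsAdTwoForm (F : SO 5 → (Fin 2 → so 5) → Matrix (Fin 3) (Fin 3) ℝ) : Prop where
  exists_bilin : ∀ g, ∃ B : so 5 →ₗ[ℝ] so 5 →ₗ[ℝ] Matrix (Fin 3) (Fin 3) ℝ,
    ∀ v, F g v = B (v 0) (v 1)
  continuous : ∀ v p q, Continuous fun g => F g v p q
  equivariant : ∀ (k : SO 3) (g : SO 5) (v : Fin 2 → so 5),
    F (g * incl k) v = (k.1)ᵀ * F g (fun i => Ad (incl k) (v i)) * k.1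

namespace IsAdTwoForm

variable {F F' : SO 5 → (Fin 2 → so 5) → Matrix (Fin 3) (Fin 3) ℝ}

theorem add (hF : IsAdTwoForm F) (hF' : IsAdTwoForm F') : IsAdTwoForm (F + F') where
  exists_bilin g := by
    obtain ⟨B, hB⟩ := hF.exists_bilin g
    obtain ⟨B', hB'⟩ := hF'.exists_bilin g
    exact ⟨B + B', fun v => by simp [hB, hB']⟩
  continuous v p q := (hF.continuous v p q).add (hF'.continuous v p q)
  equivariant k g v := by
    simp only [Pi.add_apply, hF.equivariant, hF'.equivariant, mul_add, add_mul]

theorem smul (c : ℝ) (hF : IsAdTwoForm F) : IsAdTwoForm (c • F) where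
  exists_bilin g := by
    obtain ⟨B, hB⟩ := hF.exists_bilin g
    exact ⟨c • B, fun v => by simp [hB]⟩
  continuous v p q := (hF.continuous v p q).const_smul c
  equivariant k g v := by
    simp only [Pi.smul_apply, hF.equivariant, Matrix.mul_smul, Matrix.smul_mul]

theorem sub (hF : IsAdTwoForm F) (hF' : IsAdTwoForm F') : IsAdTwoForm (F - F') := by
  rw [show F - F' = F + (-1 : ℝ) • F' by rw [neg_one_smul, sub_eq_add_neg]]
  exact hF.add (hF'.smul _)

theorem flip (hF : IsAdTwoForm F) : IsAdTwoForm fun g v => F g ![v 1, v 0] where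
  exists_bilin g := by
    obtain ⟨B, hB⟩ := hF.exists_bilin g
    exact ⟨B.flip, fun v => by simp [hB]⟩
  continuous v p q := hF.continuous _ p q
  equivariant k g v := by
    rw [hF.equivariant]
    congr 3
    ext1 i
    fin_cases i <;> rfl

end IsAdTwoForm

section OneForms

variable {A A' : OneForm}

theorem Equivariant.apply_mul_incl (hA : Equivariant A) (k : SO 3) (g : SO 5) (X : so 5) :
    (A (g * incl k) X).1 = (k.1)ᵀ * (A g (Ad (incl k) X)).1 * k.1 := hA k g X

theorem isAdTwoForm_mul (hs : SmoothForm A) (hA : Equivariant A) (hs' : SmoothForm A')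
    (hA' : Equivariant A') : IsAdTwoForm fun g v => (A g (v 0)).1 * (A' g (v 1)).1 where
  exists_bilin g := ⟨LinearMap.mk₂ ℝ (fun X Y => (A g X).1 * (A' g Y).1)
    (fun X X' Y => by simp [add_mul]) (fun c X Y => by simp) (fun X Y Y' => by simp [mul_add])
    (fun c X Y => by simp), fun v => rfl⟩
  continuous v p q := by
    simp only [Matrix.mul_apply]
    exact continuous_finsetSum _ fun r _ => (hs _ p r).continuous.mul (hs' _ r q).continuous
  equivariant k g v := by
    have hk : k.1 * (k.1)ᵀ = 1 := (Matrix.mem_orthogonalGroup_iff (Fin 3) ℝ).1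
      (Matrix.mem_specialOrthogonalGroup_iff.1 k.2).1
    simp only [hA.apply_mul_incl, hA'.apply_mul_incl]
    calc _ = (k.1)ᵀ * (A g (Ad (incl k) (v 0))).1 * (k.1 * (k.1)ᵀ) *
          (A' g (Ad (incl k) (v 1))).1 * k.1 := by simp only [mul_assoc]
      _ = _ := by rw [hk, mul_one]; simp only [mul_assoc]

/-- The derivative of `A(Y)` along the left-invariant vector field of `X`. -/
noncomputable def derivForm (A : OneForm) (g : SO 5) (v : Fin 2 → so 5) :
    Matrix (Fin 3) (Fin 3) ℝ :=
  Matrix.of fun p q => lieD (v 0) (fun g' => (A g' (v 1)).1 p q) g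

theorem lieD_form_add (hs : SmoothForm A) (X Y Y' : so 5) (p q : Fin 3) (g : SO 5) :
    lieD X (fun g' => (A g' (Y + Y')).1 p q) g =
      lieD X (fun g' => (A g' Y).1 p q) g + lieD X (fun g' => (A g' Y').1 p q) g := by
  simp only [map_add]
  exact lieD_eq_of_hasDerivAt (((hs Y p q).hasDerivAt_zero g X).add
    ((hs Y' p q).hasDerivAt_zero g X))

theorem lieD_form_smul (hs : SmoothForm A) (c : ℝ) (X Y : so 5) (p q : Fin 3) (g : SO 5) :
    lieD X (fun g' => (A g' (c • Y)).1 p q) g = c * lieD X (fun g' => (A g' Y).1 p q) g := by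
  simp only [map_smul]
  exact lieD_eq_of_hasDerivAt (((hs Y p q).hasDerivAt_zero g X).const_mul c)

/-- Right translation by k replaces the field of X by that of Ad(k)X, and conjugation by the
constant matrix k commutes with differentiation. -/
theorem isAdTwoForm_derivForm (hs : SmoothForm A) (hA : Equivariant A) :
    IsAdTwoForm (derivForm A) where
  exists_bilin g := ⟨LinearMap.mk₂ ℝ (fun X Y => derivForm A g ![X, Y])
    (fun X X' Y => by ext p q; exact (hs Y p q).lieD_add X X' g)
    (fun c X Y => by ext p q; exact (hs Y p q).lieD_smul c X g)
    (fun X Y Y' => by ext p q; exact lieD_form_add hs X Y Y' p q g)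
    (fun c X Y => by ext p q; exact lieD_form_smul hs c X Y p q g), fun v => rfl⟩
  continuous v p q := (hs (v 1) p q).continuous_lieD (v 0)
  equivariant k g v := by
    ext p q
    simp only [derivForm, Matrix.of_apply, lieD_mul_right _ _ _ (incl k), hA.apply_mul_incl,
      Matrix.mul_apply, Finset.sum_mul, Matrix.transpose_apply]
    exact lieD_eq_of_hasDerivAt (HasDerivAt.fun_sum fun j _ => HasDerivAt.fun_sum fun i _ =>
      (((hs _ i j).hasDerivAt_zero g _).const_mul _).mul_const _)

theorem bracket_Ad (k : SO 5) (X Y : so 5) : Ad k ⁅X, Y⁆ = ⁅Ad k X, Ad k Y⁆ := by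
  apply Subtype.ext
  change k.1 * (X.1 * Y.1 - Y.1 * X.1) * (k.1)ᵀ =
    (k.1 * X.1 * (k.1)ᵀ) * (k.1 * Y.1 * (k.1)ᵀ) - (k.1 * Y.1 * (k.1)ᵀ) * (k.1 * X.1 * (k.1)ᵀ)
  have h : ∀ Z W : Matrix (Fin 5) (Fin 5) ℝ,
      (k.1 * Z * (k.1)ᵀ) * (k.1 * W * (k.1)ᵀ) = k.1 * (Z * W) * (k.1)ᵀ := by
    intro Z W
    calc _ = k.1 * Z * ((k.1)ᵀ * k.1) * W * (k.1)ᵀ := by simp only [mul_assoc]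
      _ = _ := by rw [transpose_mul_SO, mul_one]; simp only [mul_assoc]
  rw [h, h, mul_sub, sub_mul]

theorem isAdTwoForm_bracket (hs : SmoothForm A) (hA : Equivariant A) :
    IsAdTwoForm fun g v => (A g ⁅v 0, v 1⁆).1 where
  exists_bilin g := ⟨LinearMap.mk₂ ℝ (fun X Y => (A g ⁅X, Y⁆).1)
    (fun X X' Y => by simp) (fun c X Y => by simp) (fun X Y Y' => by simp)
    (fun c X Y => by simp), fun v => rfl⟩
  continuous v p q := (hs _ p q).continuous
  equivariant k g v := by
    rw [hA.apply_mul_incl, bracket_Ad]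

theorem dOne_eq (A : OneForm) : dOne A =
    derivForm A - (fun g v => derivForm A g ![v 1, v 0]) - fun g v => (A g ⁅v 0, v 1⁆).1 := by
  funext g v
  ext p q
  rw [dOne_apply]
  rfl

theorem isAdTwoForm_dOne (hs : SmoothForm A) (hA : Equivariant A) : IsAdTwoForm (dOne A) := by
  rw [dOne_eq]
  exact ((isAdTwoForm_derivForm hs hA).sub (isAdTwoForm_derivForm hs hA).flip).sub
    (isAdTwoForm_bracket hs hA)

theorem isAdTwoForm_curvature (hs : SmoothForm A) (hA : Equivariant A) :
    IsAdTwoForm (curvature A) :=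
  (isAdTwoForm_dOne hs hA).add
    ((isAdTwoForm_mul hs hA hs hA).sub (isAdTwoForm_mul hs hA hs hA).flip)

theorem isAdTwoForm_dCov (hs : SmoothForm A) (hA : Equivariant A) (hs' : SmoothForm A')
    (hA' : Equivariant A') : IsAdTwoForm (dCov A A') :=
  (isAdTwoForm_dOne hs' hA').add
    (((isAdTwoForm_mul hs hA hs' hA').sub (isAdTwoForm_mul hs' hA' hs hA).flip).sub
      ((isAdTwoForm_mul hs hA hs' hA').flip.sub (isAdTwoForm_mul hs' hA' hs hA)))

end OneForms

/-! ### The pointwise inner product of 2-forms -/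

theorem ip_eq_sum (A B : Matrix (Fin 3) (Fin 3) ℝ) :
    ip A B = (1 / 2) * ∑ p, ∑ q, A p q * B p q := by
  simp [ip, Matrix.trace, Matrix.mul_apply]

/-- `ip` as a bilinear map. -/
noncomputable def ipBilin :
    Matrix (Fin 3) (Fin 3) ℝ →ₗ[ℝ] Matrix (Fin 3) (Fin 3) ℝ →ₗ[ℝ] ℝ :=
  LinearMap.mk₂ ℝ ip (fun A B C => by simp [ip, add_mul, mul_add])
    (fun c A B => by simp [ip, mul_left_comm]) (fun A B C => by simp [ip, mul_add])
    (fun c A B => by simp [ip, mul_left_comm])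

theorem ipBilin_apply (A B : Matrix (Fin 3) (Fin 3) ℝ) : ipBilin A B = ip A B := rfl

theorem ip_comm (A B : Matrix (Fin 3) (Fin 3) ℝ) : ip A B = ip B A := by
  simp only [ip_eq_sum, mul_comm]

theorem ip_conj (k : SO 3) (A B : Matrix (Fin 3) (Fin 3) ℝ) :
    ip ((k.1)ᵀ * A * k.1) ((k.1)ᵀ * B * k.1) = ip A B := by
  have hk : k.1 * (k.1)ᵀ = 1 := (Matrix.mem_orthogonalGroup_iff (Fin 3) ℝ).1
    (Matrix.mem_specialOrthogonalGroup_iff.1 k.2).1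
  simp only [ip, Matrix.transpose_mul, Matrix.transpose_transpose]
  congr 1
  calc _ = ((k.1)ᵀ * (A * (k.1 * (k.1)ᵀ) * Bᵀ * k.1)).trace := by simp only [mul_assoc]
    _ = _ := by
      rw [Matrix.trace_mul_comm, hk, mul_one, mul_assoc, hk, mul_one]

theorem so_ext {X Y : so 5} (h1 : ∀ m n, X.1 (idxL m) (idxL n) = Y.1 (idxL m) (idxL n))
    (h2 : ∀ m p, X.1 (idxL m) (idxR p) = Y.1 (idxL m) (idxR p))
    (h3 : ∀ p q, X.1 (idxR p) (idxR q) = Y.1 (idxR p) (idxR q)) : X = Y := by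
  apply Subtype.ext
  ext i j
  refine Fin.addCases (m := 2) (n := 3) (fun m => ?_) (fun p => ?_) i <;>
    refine Fin.addCases (m := 2) (n := 3) (fun n => ?_) (fun q => ?_) j
  · exact h1 m n
  · exact h2 m q
  · have h := h2 n p
    rw [so_apply_swap X (idxL n) (idxR p), so_apply_swap Y (idxL n) (idxR p), h]
  · exact h3 p q

theorem e_zero_LR (m : Fin 2) (p : Fin 3) : (e 0).1 (idxL m) (idxR p) = 0 := by
  fin_cases m <;> fin_cases p <;> simp [e, pos, idxL, idxR]

theorem e_zero_RR (p q : Fin 3) : (e 0).1 (idxR p) (idxR q) = 0 := by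
  fin_cases p <;> fin_cases q <;> simp [e, pos, idxR]

theorem e_hIdx_LL (m : Fin 2) (p : Fin 3) (n n' : Fin 2) :
    (e (hIdx m p)).1 (idxL n) (idxL n') = 0 := by
  fin_cases m <;> fin_cases p <;> fin_cases n <;> fin_cases n' <;>
    simp [e, hIdx, pos, idxL]

theorem e_hIdx_LR (m : Fin 2) (p : Fin 3) (n : Fin 2) (q : Fin 3) :
    (e (hIdx m p)).1 (idxL n) (idxR q) = if n = m then if q = p then 1 else 0 else 0 := by
  rw [← co_hIdx, co_e]
  fin_cases m <;> fin_cases p <;> fin_cases n <;> fin_cases q <;> simp [hIdx]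

theorem e_hIdx_RR (m : Fin 2) (p q r : Fin 3) : (e (hIdx m p)).1 (idxR q) (idxR r) = 0 := by
  fin_cases m <;> fin_cases p <;> fin_cases q <;> fin_cases r <;>
    simp [e, hIdx, pos, idxR]

theorem Ad_e_zero (k : SO 3) : Ad (incl k) (e 0) = e 0 :=
  so_ext (fun m n => Ad_incl_LL k _ m n) (fun m p => by simp only [Ad_incl_LR, e_zero_LR]; simp)
    (fun p q => by simp only [Ad_incl_RR, e_zero_RR]; simp)

theorem so_sum_smul_apply {ι : Type*} (s : Finset ι) (c : ι → ℝ) (X : ι → so 5) (i j : Fin 5) :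
    (∑ a ∈ s, c a • X a : so 5).1 i j = ∑ a ∈ s, c a * (X a).1 i j := by
  have h : (∑ a ∈ s, c a • X a : so 5).1 = ∑ a ∈ s, c a • (X a).1 := by simp
  rw [h, Matrix.sum_apply]
  rfl

theorem Ad_e_hIdx (k : SO 3) (m : Fin 2) (p : Fin 3) :
    Ad (incl k) (e (hIdx m p)) = ∑ q, k.1 q p • e (hIdx m q) := by
  refine so_ext (fun n n' => ?_) (fun n q => ?_) (fun q r => ?_)
  · simp only [Ad_incl_LL, so_sum_smul_apply, e_hIdx_LL]
    simp
  · simp only [Ad_incl_LR, so_sum_smul_apply, e_hIdx_LR]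
    by_cases h : n = m <;> simp [h]
  · simp only [Ad_incl_RR, so_sum_smul_apply, e_hIdx_RR]
    simp

theorem sum_mIdx {M : Type*} [AddCommMonoid M] (F : Fin 10 → M) :
    ∑ i, F (mIdx i) = F 0 + ∑ m, ∑ p, F (hIdx m p) := by
  rw [Fin.sum_univ_succ]
  simp only [Fin.sum_univ_two, Fin.sum_univ_three, Fin.sum_univ_six]
  change F 0 + (F 1 + F 2 + F 3 + F 4 + F 5 + F 6) = F 0 + ((F 1 + F 2 + F 3) + (F 4 + F 5 + F 6))
  simp only [add_assoc]

theorem sum_weight_mul (s t : ℝ) (F : Fin 10 → ℝ) :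
    ∑ i : Fin 7, (if i = 0 then s else t) * F (mIdx i) =
      s * F 0 + t * ∑ m, ∑ p, F (hIdx m p) := by
  have h := sum_mIdx fun i => (if i = 0 then s else t) * F i
  have h0 : ∀ i : Fin 7, (if mIdx i = 0 then s else t) = if i = 0 then s else t := by
    intro i
    fin_cases i <;> rfl
  simp only [h0] at h
  rw [h, if_pos trivial, Finset.mul_sum]
  congr 1
  refine Finset.sum_congr rfl fun m _ => ?_
  rw [Finset.mul_sum]
  refine Finset.sum_congr rfl fun p _ => ?_
  rw [if_neg]
  revert m p
  decide

/-- e₁ is fixed, and each of the two standard summands is rotated by an orthogonal matrix while its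
weight is constant, so a weighted trace of a bilinear form does not change. -/
theorem sum_weight_Ad (s t : ℝ) (k : SO 3) (C : so 5 →ₗ[ℝ] so 5 →ₗ[ℝ] ℝ) :
    ∑ i : Fin 7, (if i = 0 then s else t) *
      C (Ad (incl k) (e (mIdx i))) (Ad (incl k) (e (mIdx i))) =
    ∑ i : Fin 7, (if i = 0 then s else t) * C (e (mIdx i)) (e (mIdx i)) := by
  have hk : k.1 * (k.1)ᵀ = 1 := (Matrix.mem_orthogonalGroup_iff (Fin 3) ℝ).1
    (Matrix.mem_specialOrthogonalGroup_iff.1 k.2).1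
  rw [sum_weight_mul s t (fun i => C (Ad (incl k) (e i)) (Ad (incl k) (e i))),
    sum_weight_mul s t (fun i => C (e i) (e i)), Ad_e_zero]
  congr 2
  refine Finset.sum_congr rfl fun m _ => ?_
  have h : ∀ q r, ∑ p, k.1 q p * k.1 r p = if q = r then 1 else 0 := by
    intro q r
    have := congrFun (congrFun hk q) r
    rw [Matrix.mul_apply, Matrix.one_apply] at this
    exact this
  have hC : ∀ p, C (Ad (incl k) (e (hIdx m p))) (Ad (incl k) (e (hIdx m p))) =
      ∑ q, ∑ r, k.1 q p * k.1 r p * C (e (hIdx m q)) (e (hIdx m r)) := by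
    intro p
    simp only [Ad_e_hIdx, map_sum, map_smul, LinearMap.sum_apply, LinearMap.smul_apply,
      smul_eq_mul, Finset.mul_sum]
    rw [Finset.sum_comm]
    refine Finset.sum_congr rfl fun q _ => Finset.sum_congr rfl fun r _ => ?_
    ring
  simp only [hC]
  rw [Finset.sum_comm]
  refine Finset.sum_congr rfl fun q _ => ?_
  rw [Finset.sum_comm]
  simp only [← Finset.sum_mul, h]
  simp

theorem ip2_of_diagonal {φ : (Fin 3 → so 5) → ℝ} {w : Fin 7 → ℝ}
    (h : (gram φ)⁻¹ = Matrix.diagonal w) {F F' : SO 5 → (Fin 2 → so 5) → Matrix (Fin 3) (Fin 3) ℝ}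
    (hF' : IsAdTwoForm F') (g : SO 5) : ip2 φ (F g) (F' g) =
      (1 / 2) * ∑ i, ∑ j, w i * (w j * ip (F g ![e (mIdx i), e (mIdx j)])
        (F' g ![e (mIdx i), e (mIdx j)])) := by
  obtain ⟨B', hB'⟩ := hF'.exists_bilin g
  rw [ip2]
  congr 1
  refine Finset.sum_congr rfl fun i _ => Finset.sum_congr rfl fun j _ => ?_
  simp [eUp_of_diagonal h, hB', ← ipBilin_apply, mul_left_comm (w i)]

/-- The pointwise product is constant along the fibres: conjugation drops out of `ip`, and the
weighted trace is invariant in each of the two slots. -/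
theorem ip2_mul_incl {φ : (Fin 3 → so 5) → ℝ} {s t : ℝ}
    (h : (gram φ)⁻¹ = Matrix.diagonal fun i => if i = 0 then s else t)
    {F F' : SO 5 → (Fin 2 → so 5) → Matrix (Fin 3) (Fin 3) ℝ}
    (hF : IsAdTwoForm F) (hF' : IsAdTwoForm F') (g : SO 5) (k : SO 3) :
    ip2 φ (F (g * incl k)) (F' (g * incl k)) = ip2 φ (F g) (F' g) := by
  rw [ip2_of_diagonal h hF', ip2_of_diagonal h hF']
  obtain ⟨B, hB⟩ := hF.exists_bilin g
  obtain ⟨B', hB'⟩ := hF'.exists_bilin g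
  simp only [hF.equivariant, hF'.equivariant, ip_conj, hB, hB', Matrix.cons_val]
  congr 1
  simp only [← Finset.mul_sum]
  have h1 : ∀ X Y, ∑ j : Fin 7, (if j = 0 then s else t) *
      ip (B X (Ad (incl k) (e (mIdx j)))) (B' Y (Ad (incl k) (e (mIdx j)))) =
      ∑ j : Fin 7, (if j = 0 then s else t) * ip (B X (e (mIdx j))) (B' Y (e (mIdx j))) :=
    fun X Y => sum_weight_Ad s t k (ipBilin.compl₁₂ (B X) (B' Y))
  simp only [h1]
  simp only [Finset.mul_sum]
  -- The second slot is done; exchanging the sums exposes the first one, treated with the flipped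
  -- bilinear maps.
  rw [Finset.sum_comm]
  conv_rhs => rw [Finset.sum_comm]
  refine Finset.sum_congr rfl fun j _ => ?_
  simp only [mul_left_comm _ (if j = 0 then s else t), ← Finset.mul_sum]
  congr 1
  exact sum_weight_Ad s t k (ipBilin.compl₁₂ (B.flip (e (mIdx j))) (B'.flip (e (mIdx j))))

theorem continuous_ip2 {φ : (Fin 3 → so 5) → ℝ} {w : Fin 7 → ℝ}
    (h : (gram φ)⁻¹ = Matrix.diagonal w) {F F' : SO 5 → (Fin 2 → so 5) → Matrix (Fin 3) (Fin 3) ℝ}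
    (hF : IsAdTwoForm F) (hF' : IsAdTwoForm F') : Continuous fun g => ip2 φ (F g) (F' g) := by
  simp only [ip2_of_diagonal h hF', ip_eq_sum]
  have h1 := hF.continuous
  have h2 := hF'.continuous
  fun_prop

/-! ### Integration over `V^{5,2}` -/

/-- By invariance the chosen representative does not matter, so the integrand descends to a
continuous function on the quotient, and integrating against the pushforward of Haar measure is
integrating on `SO 5`. -/
theorem integral_volV_out (φ : (Fin 3 → so 5) → ℝ) {f : SO 5 → ℝ} (hf : Continuous f)
    (hinv : ∀ g k, f (g * incl k) = f g) : ∫ p : V52, f p.out ∂(volV φ) =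
      (ENNReal.ofReal (√(gram φ).det * (16 * Real.pi ^ 4 / 3))).toReal *
        ∫ g, f g ∂haarSO := by
  have hout : ∀ g : SO 5, f (g : V52).out = f g := by
    intro g
    obtain ⟨⟨_, k, rfl⟩, hk⟩ := QuotientGroup.mk_out_eq_mul incl.range g
    rw [hk]
    exact hinv g k
  have hc : Continuous fun p : V52 => f p.out := by
    rw [(QuotientGroup.isQuotientMap_mk incl.range).continuous_iff]
    exact hf.congr fun g => (hout g).symm
  rw [volV, integral_smul_measure, integral_map QuotientGroup.continuous_mk.measurable.aemeasurable
    hc.aestronglyMeasurable]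
  simp only [hout, smul_eq_mul]

/-! ### The Yang–Mills equation -/

theorem so_bracket_apply_idx (X Y : so 5) (i j : Fin 5) : (⁅X, Y⁆ : so 5).1 i j =
    ∑ m, (X.1 i (idxL m) * Y.1 (idxL m) j - Y.1 i (idxL m) * X.1 (idxL m) j) +
      ∑ p, (X.1 i (idxR p) * Y.1 (idxR p) j - Y.1 i (idxR p) * X.1 (idxR p) j) := by
  rw [so_bracket_apply, sum_idx]

theorem eq_lieIncl {X : so 5} (h1 : ∀ m n, X.1 (idxL m) (idxL n) = 0)
    (h2 : ∀ m p, X.1 (idxL m) (idxR p) = 0) : X = lieIncl (alpha 1 X) := by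
  refine so_ext (fun m n => ?_) (fun m p => ?_) fun p q => ?_
  · exact (h1 m n).trans (block_LL 0 _ m n).symm
  · exact (h2 m p).trans (block_LR 0 _ m p).symm
  · exact (alpha_apply 1 X p q).symm.trans (block_RR 0 _ p q).symm

theorem bracket_e_hIdx (m : Fin 2) (p q : Fin 3) :
    ∃ s, ⁅e (hIdx m p), e (hIdx m q)⁆ = lieIncl s := by
  refine ⟨_, eq_lieIncl (fun n n' => ?_) fun n r => ?_⟩
  · simp only [so_bracket_apply_idx, e_hIdx_LL, so_apply_swap _ (idxL _) (idxR _), e_hIdx_LR]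
    by_cases h : n = m <;> by_cases h' : n' = m <;> simp [h, h']
    exact Finset.sum_eq_zero fun x _ => by split_ifs <;> simp
  · simp only [so_bracket_apply_idx, e_hIdx_LL, e_hIdx_RR]
    simp

theorem mIdx_cases : ∀ i : Fin 7, mIdx i = 0 ∨ ∃ m p, mIdx i = hIdx m p := by
  decide

/-- F_α pairs only vectors from the same row of the off-diagonal block, and two such basis vectors
have their bracket in 𝔰𝔬(3). This dichotomy is what makes α Yang–Mills. -/
theorem curvature_alpha_basis (g : SO 5) (i j : Fin 7) :
    curvature alpha g ![e (mIdx i), e (mIdx j)] = 0 ∨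
      ∃ s, ⁅e (mIdx i), e (mIdx j)⁆ = lieIncl s := by
  rcases mIdx_cases i with hi | ⟨m, p, hi⟩
  · left
    ext r r'
    rw [curvature_alpha]
    simp [coWedge_pair, co_hIdx, hi, e_zero_LR, -Fin.natAdd_eq_addNat]
  rcases mIdx_cases j with hj | ⟨n, q, hj⟩
  · left
    ext r r'
    rw [curvature_alpha]
    simp [coWedge_pair, co_hIdx, hj, e_zero_LR, -Fin.natAdd_eq_addNat]
  rcases eq_or_ne m n with rfl | hmn
  · right
    rw [hi, hj]
    exact bracket_e_hIdx m p q
  · left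
    ext r r'
    rw [curvature_alpha]
    refine Finset.sum_eq_zero fun l _ => ?_
    simp only [coWedge_pair, co_hIdx, hi, hj, Matrix.cons_val, e_hIdx_LR]
    by_cases hl : l = m
    · simp [hl, hmn]
    · simp [hl]

theorem curvature_alpha_const (g : SO 5) : curvature alpha g = curvature alpha 1 := by
  funext v
  ext p q
  rw [curvature_alpha, curvature_alpha]

theorem alpha_e (g : SO 5) (i : Fin 7) : (alpha g (e (mIdx i))).1 = 0 := by
  ext p q
  rw [alpha_apply]
  rcases mIdx_cases i with hi | ⟨m, r, hi⟩
  · rw [hi, e_zero_RR]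
    rfl
  · rw [hi, e_hIdx_RR]
    rfl

/-- When the bracket is vertical, horizontality of β removes the bracket term of dβ, and the two
remaining derivatives integrate to zero against the constant K. -/
theorem integral_ip_dOne {β : OneForm} (hβ : IsAdForm β) (K : Matrix (Fin 3) (Fin 3) ℝ)
    {X Y : so 5} (h : K = 0 ∨ ∃ s, ⁅X, Y⁆ = lieIncl s) :
    Integrable (fun g => ip K (dOne β g ![X, Y])) haarSO ∧
      ∫ g, ip K (dOne β g ![X, Y]) ∂haarSO = 0 := by
  rcases h with rfl | ⟨s, hs⟩
  · simp [ip]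
  have hd : ∀ g p q, dOne β g ![X, Y] p q = lieD X (fun g' => (β g' Y).1 p q) g -
      lieD Y (fun g' => (β g' X).1 p q) g := by
    intro g p q
    rw [dOne_apply]
    simp [hs, hβ.horizontal]
  have hi : ∀ X Y p q, Integrable (lieD X (fun g' => (β g' Y).1 p q)) haarSO :=
    fun X Y p q => integrable_of_continuous ((hβ.smooth Y p q).continuous_lieD X)
  have hi2 : ∀ p q, Integrable (fun g => K p q * (lieD X (fun g' => (β g' Y).1 p q) g -
      lieD Y (fun g' => (β g' X).1 p q) g)) haarSO :=
    fun p q => ((hi X Y p q).sub (hi Y X p q)).const_mul _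
  simp only [ip_eq_sum, hd]
  refine ⟨(integrable_finsetSum _ fun p _ => integrable_finsetSum _ fun q _ => hi2 p q).const_mul _,
    ?_⟩
  rw [integral_const_mul, integral_finsetSum _ fun p _ => integrable_finsetSum _ fun q _ => hi2 p q]
  rw [Finset.sum_eq_zero, mul_zero]
  intro p _
  rw [integral_finsetSum _ fun q _ => hi2 p q]
  refine Finset.sum_eq_zero fun q _ => ?_
  rw [integral_const_mul, integral_sub (hi X Y p q) (hi Y X p q), integral_lieD (hβ.smooth Y p q),
    integral_lieD (hβ.smooth X p q), sub_zero, mul_zero]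

theorem integral_ip2_curvature_dCov {φ : (Fin 3 → so 5) → ℝ} {w : Fin 7 → ℝ}
    (h : (gram φ)⁻¹ = Matrix.diagonal w) {β : OneForm} (hβ : IsAdForm β) :
    ∫ g, ip2 φ (curvature alpha g) (dCov alpha β g) ∂haarSO = 0 := by
  have hα := isConnection_alpha
  -- α vanishes on 𝔪, so the term [α ∧ β] does not contribute on these vectors.
  have hd : ∀ g i j, dCov alpha β g ![e (mIdx i), e (mIdx j)] =
      dOne β g ![e (mIdx i), e (mIdx j)] := by
    intro g i j
    simp [dCov, alpha_e, Ring.lie_def]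
  have heq : ∀ g, ip2 φ (curvature alpha g) (dCov alpha β g) =
      (1 / 2) * ∑ i, ∑ j, w i * (w j * ip (curvature alpha 1 ![e (mIdx i), e (mIdx j)])
        (dOne β g ![e (mIdx i), e (mIdx j)])) := by
    intro g
    rw [ip2_of_diagonal h
      (isAdTwoForm_dCov hα.smooth hα.equivariant hβ.smooth hβ.equivariant), curvature_alpha_const g]
    simp only [hd]
  simp only [heq]
  have key := fun i j => integral_ip_dOne hβ _ (curvature_alpha_basis 1 i j)
  have hi := fun i j => ((key i j).1.const_mul (w j)).const_mul (w i)
  rw [integral_const_mul, integral_finsetSum _ fun i _ => integrable_finsetSum _ fun j _ => hi i j]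
  rw [Finset.sum_eq_zero, mul_zero]
  intro i _
  rw [integral_finsetSum _ fun j _ => hi i j]
  refine Finset.sum_eq_zero fun j _ => ?_
  rw [integral_const_mul, integral_const_mul, (key i j).2, mul_zero, mul_zero]

theorem l2Two_eq {φ : (Fin 3 → so 5) → ℝ} {s t : ℝ}
    (h : (gram φ)⁻¹ = Matrix.diagonal fun i => if i = 0 then s else t)
    {F F' : SO 5 → (Fin 2 → so 5) → Matrix (Fin 3) (Fin 3) ℝ}
    (hF : IsAdTwoForm F) (hF' : IsAdTwoForm F') : l2Two φ F F' =
      (ENNReal.ofReal (√(gram φ).det * (16 * Real.pi ^ 4 / 3))).toReal *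
        ∫ g, ip2 φ (F g) (F' g) ∂haarSO :=
  integral_volV_out φ (f := fun g => ip2 φ (F g) (F' g)) (continuous_ip2 h hF hF')
    (ip2_mul_incl h hF hF')

theorem isCodifferential_alpha (a b z : ℝ) :
    IsCodifferential (phi a b a b z) alpha (curvature alpha) 0 := by
  obtain ⟨s, t, h⟩ := exists_gram_phi_inv a b z
  have hα := isConnection_alpha
  refine ⟨⟨fun X p q => ⟨fun _ => 0, contDiff_const, fun _ => rfl⟩, fun k g X => by simp,
    fun g s => rfl⟩, fun β hβ => ?_⟩
  rw [l2Two_eq h (isAdTwoForm_curvature hα.smooth hα.equivariant)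
    (isAdTwoForm_dCov hα.smooth hα.equivariant hβ.smooth hβ.equivariant),
    integral_ip2_curvature_dCov h hβ]
  simp [l2One, ip1, ip]

/-! ### The first variation of the Yang–Mills functional -/

theorem curvature_alpha_add {β : OneForm} (hβ : IsAdForm β) (t : ℝ) :
    curvature (alpha + t • β) = curvature alpha + t • dCov alpha β +
      t ^ 2 • ((fun (g : SO 5) (v : Fin 2 → so 5) => (β g (v 0)).1 * (β g (v 1)).1) -
        fun g v => (β g (v 1)).1 * (β g (v 0)).1) := by
  funext g v
  have hd : dOne (alpha + t • β) g v = dOne alpha g v + t • dOne β g v := by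
    ext p q
    -- α has constant coefficients in the left-invariant trivialisation, so only β is
    -- differentiated.
    have h : ∀ X Y, lieD X (fun g' => ((alpha + t • β) g' Y).1 p q) g =
        t * lieD X (fun g' => (β g' Y).1 p q) g := fun X Y =>
      lieD_const_add_mul (hβ.smooth Y p q) ((alpha g Y).1 p q) t X g
    rw [Matrix.add_apply, Matrix.smul_apply, dOne_apply, dOne_apply, dOne_apply, h, h]
    have h0 : ∀ X Y, lieD X (fun g' => (alpha g' Y).1 p q) g = 0 := fun X Y => lieD_const _ _ _
    rw [h0, h0]
    simp
    ring
  have hc : ∀ X, ((alpha + t • β) g X).1 = (alpha g X).1 + t • (β g X).1 := fun _ => rfl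
  rw [curvature]
  simp only [hd, hc]
  simp only [curvature, Pi.add_apply, Pi.smul_apply, Pi.sub_apply, dCov, Ring.lie_def, add_mul,
    mul_add, smul_add, smul_sub, Matrix.smul_mul, Matrix.mul_smul, smul_smul, pow_two]
  abel

theorem ip2_add_left (φ : (Fin 3 → so 5) → ℝ) (F F' G : (Fin 2 → so 5) → Matrix (Fin 3) (Fin 3) ℝ) :
    ip2 φ (F + F') G = ip2 φ F G + ip2 φ F' G := by
  simp [ip2, ← ipBilin_apply, Finset.sum_add_distrib, mul_add]

theorem ip2_add_right (φ : (Fin 3 → so 5) → ℝ)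
    (F G G' : (Fin 2 → so 5) → Matrix (Fin 3) (Fin 3) ℝ) :
    ip2 φ F (G + G') = ip2 φ F G + ip2 φ F G' := by
  simp [ip2, ← ipBilin_apply, Finset.sum_add_distrib, mul_add]

theorem ip2_smul_left (φ : (Fin 3 → so 5) → ℝ) (c : ℝ)
    (F G : (Fin 2 → so 5) → Matrix (Fin 3) (Fin 3) ℝ) : ip2 φ (c • F) G = c * ip2 φ F G := by
  simp [ip2, ← ipBilin_apply, Finset.mul_sum, mul_left_comm]

theorem ip2_smul_right (φ : (Fin 3 → so 5) → ℝ) (c : ℝ)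
    (F G : (Fin 2 → so 5) → Matrix (Fin 3) (Fin 3) ℝ) : ip2 φ F (c • G) = c * ip2 φ F G := by
  simp [ip2, ← ipBilin_apply, Finset.mul_sum, mul_left_comm]

theorem ip2_comm_of_diagonal {φ : (Fin 3 → so 5) → ℝ} {w : Fin 7 → ℝ}
    (h : (gram φ)⁻¹ = Matrix.diagonal w) {F F' : SO 5 → (Fin 2 → so 5) → Matrix (Fin 3) (Fin 3) ℝ}
    (hF : IsAdTwoForm F) (hF' : IsAdTwoForm F') (g : SO 5) :
    ip2 φ (F g) (F' g) = ip2 φ (F' g) (F g) := by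
  simp only [ip2_of_diagonal h hF', ip2_of_diagonal h hF, ip_comm (F g _)]

/-- YM(α + tβ) is a quartic polynomial in t with linear coefficient 2∫⟨F_α, d_αβ⟩, which vanishes by
`integral_ip2_curvature_dCov`. -/
theorem isYangMills_alpha (a b z : ℝ) : IsYangMills (phi a b a b z) alpha := by
  refine ⟨isConnection_alpha, fun β hβ => ?_⟩
  obtain ⟨s₀, t₀, h⟩ := exists_gram_phi_inv a b z
  have hα := isConnection_alpha
  set φ := phi a b a b z
  set c := (ENNReal.ofReal (√(gram φ).det * (16 * Real.pi ^ 4 / 3))).toReal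
  have hF := isAdTwoForm_curvature hα.smooth hα.equivariant
  have hG := isAdTwoForm_dCov hα.smooth hα.equivariant hβ.smooth hβ.equivariant
  have hQ := (isAdTwoForm_mul hβ.smooth hβ.equivariant hβ.smooth hβ.equivariant).sub
    (isAdTwoForm_mul hβ.smooth hβ.equivariant hβ.smooth hβ.equivariant).flip
  set F := curvature alpha
  set G := dCov alpha β
  set Q := (fun (g : SO 5) (v : Fin 2 → so 5) => (β g (v 0)).1 * (β g (v 1)).1) -
    fun g v => (β g (v 1)).1 * (β g (v 0)).1
  have hQ : IsAdTwoForm Q := hQ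
  let I (A B : SO 5 → (Fin 2 → so 5) → Matrix (Fin 3) (Fin 3) ℝ) : ℝ :=
    ∫ g, ip2 φ (A g) (B g) ∂haarSO
  have hint : ∀ {A B}, IsAdTwoForm A → IsAdTwoForm B →
      Integrable (fun g => ip2 φ (A g) (B g)) haarSO :=
    fun hA hB => integrable_of_continuous (continuous_ip2 h hA hB)
  have hYM : ∀ t : ℝ, YM φ (alpha + t • β) = c * I F F + t * (2 * (c * I F G)) +
      t ^ 2 * (c * (I G G + 2 * I F Q)) + t ^ 3 * (2 * (c * I G Q)) + t ^ 4 * (c * I Q Q) := by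
    intro t
    have hsum := (hF.add (hG.smul t)).add (hQ.smul (t ^ 2))
    rw [YM, curvature_alpha_add hβ, l2Two_eq h hsum hsum]
    have hexp : ∀ g, ip2 φ ((F + t • G + t ^ 2 • Q) g) ((F + t • G + t ^ 2 • Q) g) =
        ip2 φ (F g) (F g) + (2 * t) * ip2 φ (F g) (G g) + t ^ 2 * ip2 φ (G g) (G g) +
          (2 * t ^ 2) * ip2 φ (F g) (Q g) + (2 * t ^ 3) * ip2 φ (G g) (Q g) +
          t ^ 4 * ip2 φ (Q g) (Q g) := by
      intro g
      simp only [Pi.add_apply, Pi.smul_apply, ip2_add_left, ip2_add_right, ip2_smul_left,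
        ip2_smul_right]
      rw [ip2_comm_of_diagonal h hG hF, ip2_comm_of_diagonal h hQ hF,
        ip2_comm_of_diagonal h hQ hG]
      ring
    have i1 := hint hF hF
    have i2 := i1.fun_add ((hint hF hG).const_mul (2 * t))
    have i3 := i2.fun_add ((hint hG hG).const_mul (t ^ 2))
    have i4 := i3.fun_add ((hint hF hQ).const_mul (2 * t ^ 2))
    have i5 := i4.fun_add ((hint hG hQ).const_mul (2 * t ^ 3))
    simp only [hexp]
    rw [integral_add i5 ((hint hQ hQ).const_mul _), integral_add i4 ((hint hG hQ).const_mul _),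
      integral_add i3 ((hint hF hQ).const_mul _), integral_add i2 ((hint hG hG).const_mul _),
      integral_add i1 ((hint hF hG).const_mul _), integral_const_mul, integral_const_mul,
      integral_const_mul, integral_const_mul, integral_const_mul]
    simp only [I]
    ring
  have h0 : I F G = 0 := integral_ip2_curvature_dCov h hβ
  simp only [hYM, h0, mul_zero, add_zero]
  -- With the linear term gone, only the powers t², t³, t⁴ remain, and each has derivative 0 at 0.
  have hp : ∀ n : ℕ, ∀ k : ℝ, HasDerivAt (fun t : ℝ => t ^ (n + 2) * k) 0 0 := by
    intro n k
    simpa using (hasDerivAt_pow (n + 2) (0 : ℝ)).mul_const k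
  exact ((((hp 0 _).const_add (c * I F F)).fun_add (hp 1 _)).fun_add (hp 2 _)).congr_deriv (by simp)

end StiefelYM

theorem mainTheorem7 (a b x y z : ℝ)
    (h₁ : 0 < a ^ 2 + b * y) (h₂ : 0 < b ^ 2 + a * x) (hz : z ≠ 0) (hxy : x * y = a * b)
    (hx : x = a) (hy : y = b) (hS : z ^ 2 = 4 * (a ^ 2 + b ^ 2) ^ (4 / 3 : ℝ)) :
    IsInvariantG2Structure (phi a b x y z) ∧ IsCoclosed (phi a b x y z) ∧
      IsInvariantConnection alpha ∧ IsG2Instanton (phi a b x y z) alpha ∧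
      IsCodifferential (phi a b x y z) alpha (curvature alpha) 0 ∧
      IsYangMills (phi a b x y z) alpha := by
  subst hx hy
  have hab : x ^ 2 + y ^ 2 ≠ 0 := by
    rw [pow_two y]
    exact h₁.ne'
  exact ⟨isInvariantG2Structure_phi hz hab, isCoclosed_phi x y z, isInvariantConnection_alpha,
    isG2Instanton_alpha x y z, isCodifferential_alpha x y z, isYangMills_alpha x y z⟩
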